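/- **Theorem (deterministic equivalent of the zero-forcing uplink SINR with pilot contamination and channel aging).** *Model.* Consider $L$ cells and fix one of them, cell $l$. For every user $k=0,1,2,\dots$ of every cell $i$ let $\beta_{lik}>0$ be the large-scale fading coefficient between that user and the base station (BS) of cell $l$. Let $p_r>0$ (transmit power) and $\alpha\in[-1,1]$ (temporal correlation) be fixed. Consider a system with $K$ users per cell, $N\ge K$ antennas per BS and a pilot matrix $\Psi\in\mathbb C^{K\times\tau}$, $\tau\ge K$, $\Psi\Psi^{\mathsf H}=I_K$, which is used in every cell, and put $p_{\rm tr}=\tau p_r$. The channel matrix $G_{li}[n-1]\in\mathbb C^{N\times K}$ has columns $\sqrt{\beta_{lik}}\,h_{lik}$ with $h_{lik}\sim\mathcal{CN}(0,I_N)$. The BS of cell $l$ receives the pilot signal $Y=\sqrt{p_{\rm tr}}\sum_{i}G_{li}[n-1]\Psi+Z$, where $Z$ has i.i.d. $\mathcal{CN}(0,1)$ entries, and forms the MMSE estimates $\hat G_{li}[n-1]$, whose columns are $$\hat g_{lik}=\beta_{lik}\Big(\tfrac1{p_{\rm tr}}+\sum_{j}\beta_{ljk}\Big)^{-1}\tfrac1{\sqrt{p_{\rm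 tr}}}\big[Y\Psi^{\mathsf H}\big]_{\cdot k}.$$ At the current symbol $G_{li}[n]=\alpha G_{li}[n-1]+E_{li}$, where column $k$ of $E_{li}$ is $\mathcal{CN}(0,(1-\alpha^2)\beta_{lik}I_N)$. All the $h_{lik}$, $Z$ and all the columns of the $E_{li}$ are independent. Put $\tilde E_{li}[n]=G_{li}[n]-\alpha\hat G_{li}[n-1]$, and let $w_k$ be row $k$ of the Moore–Penrose pseudo-inverse of $\hat G_{ll}[n-1]$. The SINR of user $k$ of cell $l$ is $$\gamma_k=\frac{\alpha^2p_r}{\alpha^2p_r\sum_{i\ne l}\|w_k\hat G_{li}[n-1]\|^2+p_r\sum_{i=1}^L\|w_k\tilde E_{li}[n]\|^2+\|w_k\|^2}.$$ Let $\hat\beta_{lik}=\beta_{lik}^2/(\sum_j\beta_{ljk}+1/p_{\rm tr})$, let $C=\sum_{i\ne l}(\beta_{lik}/\beta_{llk})^2$, and let $\tilde D_{li}$ be the $K\times K$ diagonal matrix with entries $\beta_{lik'}-\alpha^2\hat\beta_{lik'}$, where $k'$ runs over the $K$ users. *Claim.* Let $\kappa\ge1$ and consider, on one probability space and with an arbitrary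 dependence between them, a sequence of such systems with strictly increasing $K$, with $N=\kappa K$, and with arbitrary $\tau\ge K$ and $\Psi$ that may change along the sequence. Assume that the spectral norms of the matrices $\tilde D_{li}$ are uniformly bounded along the sequence, and that at least one of the following holds: (a) $\kappa>1$ and $L\ge2$; (b) $\sum_{i=1}^L\frac1K\operatorname{Tr}\tilde D_{li}$ is eventually bounded below by a positive constant. Then for every fixed user $k$ (present in all the systems), $\gamma_k-\bar\gamma_k\to0$ almost surely along the sequence, where $$\bar\gamma_k=\frac{\alpha^2\hat\beta_{llk}(\kappa-1)}{\alpha^2C\hat\beta_{llk}(\kappa-1)+\sum_{i=1}^L\frac1K\operatorname{Tr}\tilde D_{li}}.$$ -/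

import Mathlib

open MeasureTheory ProbabilityTheory Filter Topology Matrix

noncomputable section

namespace ZFUplink

/-- The circularly symmetric complex Gaussian law `CN(0, v)` on `ℂ`: the real and imaginary
parts are independent real centred Gaussians of variance `v / 2` (a Dirac mass if `v = 0`). -/
def complexGaussian (v : NNReal) : Measure ℂ :=
  ((gaussianReal 0 (v / 2)).prod (gaussianReal 0 (v / 2))).map
    Complex.measurableEquivRealProd.symm

/-- `B` is a Moore-Penrose pseudo-inverse of the complex matrix `A`. -/
structure IsPseudoInverse {m n : ℕ} (A : Matrix (Fin m) (Fin n) ℂ)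
    (B : Matrix (Fin n) (Fin m) ℂ) : Prop where
  mul_mul_left : A * B * A = A
  mul_mul_right : B * A * B = B
  herm_left : (A * B)ᴴ = A * B
  herm_right : (B * A)ᴴ = B * A

open scoped ComplexOrder in
/-- Every complex matrix has a Moore-Penrose pseudo-inverse. -/
theorem exists_isPseudoInverse {m n : ℕ} (A : Matrix (Fin m) (Fin n) ℂ) :
    ∃ B, IsPseudoInverse A B := by
  have hH : (Aᴴ * A).IsHermitian := isHermitian_conjTranspose_mul_self A
  obtain ⟨G, hG, hGH, h1, h2⟩ : ∃ G : Matrix (Fin n) (Fin n) ℂ, Gᴴ = G ∧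
      G * (Aᴴ * A) = (Aᴴ * A) * G ∧ (Aᴴ * A) * G * (Aᴴ * A) = Aᴴ * A ∧
      G * (Aᴴ * A) * G = G := by
    obtain ⟨U, c, hUU, hs⟩ : ∃ (U : Matrix (Fin n) (Fin n) ℂ) (c : Fin n → ℝ), Uᴴ * U = 1 ∧
        Aᴴ * A = U * diagonal (fun i => (c i : ℂ)) * Uᴴ := by
      refine ⟨(hH.eigenvectorUnitary : Matrix (Fin n) (Fin n) ℂ), hH.eigenvalues, ?_, ?_⟩
      · rw [← star_eq_conjTranspose]
        exact Unitary.coe_star_mul_self hH.eigenvectorUnitary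
      · conv_lhs => rw [hH.spectral_theorem]
        rfl
    have hcancel : ∀ d e : Fin n → ℂ, U * diagonal d * Uᴴ * (U * diagonal e * Uᴴ)
        = U * diagonal (fun i => d i * e i) * Uᴴ := by
      intro d e
      calc U * diagonal d * Uᴴ * (U * diagonal e * Uᴴ)
          = U * diagonal d * (Uᴴ * U) * diagonal e * Uᴴ := by simp only [Matrix.mul_assoc]
        _ = _ := by rw [hUU, Matrix.mul_one, Matrix.mul_assoc U, diagonal_mul_diagonal]
    refine ⟨U * diagonal (fun i => (c i : ℂ)⁻¹) * Uᴴ, ?_, ?_, ?_, ?_⟩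
    · rw [conjTranspose_mul, conjTranspose_mul, conjTranspose_conjTranspose,
        diagonal_conjTranspose, Matrix.mul_assoc]
      congr 3
      funext i
      simp
    · rw [hs, hcancel, hcancel]
      congr 3
      funext i
      exact mul_comm _ _
    · rw [hs, hcancel, hcancel]
      congr 3
      funext i
      exact mul_inv_mul_cancel _
    · rw [hs, hcancel, hcancel]
      congr 3
      funext i
      rcases eq_or_ne (c i : ℂ) 0 with h | h
      · simp [h]
      · field_simp
  have hAGH : A * (G * (Aᴴ * A)) = A := by
    have h0 : A * (G * (Aᴴ * A) - 1) = 0 := by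
      rw [← conjTranspose_mul_self_eq_zero]
      have h3 : Aᴴ * (A * (G * (Aᴴ * A) - 1)) = 0 := by
        rw [← Matrix.mul_assoc, Matrix.mul_sub, Matrix.mul_one, ← Matrix.mul_assoc, h1, sub_self]
      rw [conjTranspose_mul, Matrix.mul_assoc, h3, Matrix.mul_zero]
    rw [Matrix.mul_sub, Matrix.mul_one, sub_eq_zero] at h0
    exact h0
  refine ⟨G * Aᴴ, ?_, ?_, ?_, ?_⟩
  · rw [Matrix.mul_assoc, Matrix.mul_assoc, hAGH]
  · calc G * Aᴴ * A * (G * Aᴴ) = G * (Aᴴ * A) * G * Aᴴ := by simp only [Matrix.mul_assoc]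
      _ = _ := by rw [h2]
  · simp only [conjTranspose_mul, conjTranspose_conjTranspose, hG, Matrix.mul_assoc]
  · rw [Matrix.mul_assoc, conjTranspose_mul, hH.eq, hG, hGH]

/-- The Moore-Penrose pseudo-inverse is unique. -/
theorem IsPseudoInverse.unique {m n : ℕ} {A : Matrix (Fin m) (Fin n) ℂ}
    {B C : Matrix (Fin n) (Fin m) ℂ} (hB : IsPseudoInverse A B) (hC : IsPseudoInverse A C) :
    B = C := by
  have e1 : A * B = A * C := by
    calc A * B = (A * B)ᴴ := hB.herm_left.symm
      _ = (A * C * (A * B))ᴴ := by rw [← Matrix.mul_assoc, hC.mul_mul_left]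
      _ = A * B * (A * C) := by rw [conjTranspose_mul, hB.herm_left, hC.herm_left]
      _ = A * C := by rw [← Matrix.mul_assoc, hB.mul_mul_left]
  have e2 : B * A = C * A := by
    calc B * A = (B * A)ᴴ := hB.herm_right.symm
      _ = (B * A * (C * A))ᴴ := by
          rw [Matrix.mul_assoc B, ← Matrix.mul_assoc A, hC.mul_mul_left]
      _ = C * A * (B * A) := by rw [conjTranspose_mul, hB.herm_right, hC.herm_right]
      _ = C * A := by rw [Matrix.mul_assoc C, ← Matrix.mul_assoc A, hB.mul_mul_left]
  calc B = B * A * B := hB.mul_mul_right.symm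
    _ = C * (A * B) := by rw [e2, Matrix.mul_assoc]
    _ = C := by rw [e1, ← Matrix.mul_assoc, hC.mul_mul_right]

/-- The Moore-Penrose pseudo-inverse `A†`. -/
def pinv {m n : ℕ} (A : Matrix (Fin m) (Fin n) ℂ) : Matrix (Fin n) (Fin m) ℂ :=
  Classical.choose (exists_isPseudoInverse A)

theorem pinv_spec {m n : ℕ} (A : Matrix (Fin m) (Fin n) ℂ) : IsPseudoInverse A (pinv A) :=
  Classical.choose_spec (exists_isPseudoInverse A)

/-- The squared Euclidean norm of a complex vector. -/
def normSq {n : ℕ} (v : Fin n → ℂ) : ℝ := ‖WithLp.toLp 2 v‖ ^ 2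

/-- The spectral norm (operator norm for the Euclidean norms) of a real square matrix. -/
def specNorm {n : ℕ} (A : Matrix (Fin n) (Fin n) ℝ) : ℝ :=
  ‖Matrix.toEuclideanCLM (n := Fin n) (𝕜 := ℝ) A‖

/-! ### Deterministic quantities

Cells are indexed by `Fin L`, the users of each cell by `0, 1, 2, …`, and `β l i k` is the
large-scale fading coefficient between the base station of cell `l` and user `k` of cell `i`.
With transmit power `p` and pilots of length `τ` the training power is `τ * p`. -/

/-- The training power `p_tr = τ p`. -/
def pTr (p : ℝ) (τ : ℕ) : ℝ := τ * p

/-- The variance `β̂_{lik} = β_{lik}² / (∑_j β_{ljk} + 1 / p_tr)` of the channel estimate. -/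
def betaHat {L : ℕ} (β : Fin L → Fin L → ℕ → ℝ) (p : ℝ) (τ : ℕ) (l i : Fin L) (k : ℕ) : ℝ :=
  β l i k ^ 2 / ((∑ j, β l j k) + 1 / pTr p τ)

/-- The pilot contamination constant `C = ∑_{i ≠ l} (β_{lik} / β_{llk})²`. -/
def contamination {L : ℕ} (β : Fin L → Fin L → ℕ → ℝ) (l : Fin L) (k : ℕ) : ℝ :=
  ∑ i ∈ Finset.univ.erase l, (β l i k / β l l k) ^ 2

/-- The diagonal matrix `D̃_{li}` with entries `β_{lik} - α² β̂_{lik}`, `k < K`. -/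
def errorCov {L : ℕ} (β : Fin L → Fin L → ℕ → ℝ) (α p : ℝ) (τ : ℕ) (l i : Fin L) (K : ℕ) :
    Matrix (Fin K) (Fin K) ℝ :=
  Matrix.diagonal fun k => β l i k - α ^ 2 * betaHat β p τ l i k

/-- `∑_i (1 / K) Tr D̃_{li}`. -/
def avgErrorTrace {L : ℕ} (β : Fin L → Fin L → ℕ → ℝ) (α p : ℝ) (τ : ℕ) (l : Fin L) (K : ℕ) :
    ℝ :=
  ∑ i, 1 / (K : ℝ) * (errorCov β α p τ l i K).trace

/-- The deterministic equivalent `γ̄_k`. -/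
def detEquiv {L : ℕ} (β : Fin L → Fin L → ℕ → ℝ) (α p κ : ℝ) (τ : ℕ) (l : Fin L) (K : ℕ)
    (k : ℕ) : ℝ :=
  α ^ 2 * betaHat β p τ l l k * (κ - 1) /
    (α ^ 2 * contamination β l k * betaHat β p τ l l k * (κ - 1) + avgErrorTrace β α p τ l K)

/-! ### The random model at the base station of cell `l` -/

/-- One realisation of all the randomness which the base station of the cell of interest sees, for
`K` users per cell, `N` antennas and pilots of length `τ`. -/
structure Sample (L K N τ : ℕ) where
  /-- small-scale fading from the users of each cell during training, at the previous symbol -/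
  fading : Fin L → Matrix (Fin N) (Fin K) ℂ
  /-- receiver noise during training -/
  noise : Matrix (Fin N) (Fin τ) ℂ
  /-- innovation of the channels from the previous symbol to the current one -/
  innov : Fin L → Matrix (Fin N) (Fin K) ℂ

/-- Index set of all the scalar entries of a sample. -/
abbrev EntryIdx (L K N τ : ℕ) : Type :=
  (Fin L × Fin N × Fin K) ⊕ (Fin N × Fin τ) ⊕ (Fin L × Fin N × Fin K)

/-- The scalar entries of a sample. -/
def Sample.entry {L K N τ : ℕ} (s : Sample L K N τ) : EntryIdx L K N τ → ℂ
  | Sum.inl (i, a, k) => s.fading i a k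
  | Sum.inr (Sum.inl (a, t)) => s.noise a t
  | Sum.inr (Sum.inr (i, a, k)) => s.innov i a k

/-- The laws of the entries: fading and noise are `CN(0, 1)`, and the innovation of the channel
of user `k` of cell `i` is `CN(0, (1 - α²) β_{lik})`. -/
def entryLaw {L K N τ : ℕ} (β : Fin L → Fin L → ℕ → ℝ) (α : ℝ) (l : Fin L) :
    EntryIdx L K N τ → Measure ℂ
  | Sum.inl _ => complexGaussian 1
  | Sum.inr (Sum.inl _) => complexGaussian 1
  | Sum.inr (Sum.inr (i, _, k)) => complexGaussian (Real.toNNReal ((1 - α ^ 2) * β l i k))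

/-- A random sample follows the model: all its entries are independent, with the above laws. -/
structure IsModel {Ω : Type*} [MeasurableSpace Ω] (P : Measure Ω) {L K N τ : ℕ}
    (β : Fin L → Fin L → ℕ → ℝ) (α : ℝ) (l : Fin L) (S : Ω → Sample L K N τ) : Prop where
  law : ∀ x, HasLaw (fun ω => (S ω).entry x) (entryLaw β α l x) P
  indep : iIndepFun (fun x ω => (S ω).entry x) P

namespace Sample

variable {L K N τ : ℕ} (s : Sample L K N τ)

/-- The channel matrix `G_{li}[n-1]`, with columns `√β_{lik} h_{lik}[n-1]`. -/
def prevChannel (β : Fin L → Fin L → ℕ → ℝ) (l i : Fin L) : Matrix (Fin N) (Fin K) ℂ :=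
  Matrix.of fun a k => ((Real.sqrt (β l i k) : ℝ) : ℂ) * s.fading i a k

/-- The channel matrix `G_{li}[n] = α G_{li}[n-1] + (innovation)`. -/
def currChannel (β : Fin L → Fin L → ℕ → ℝ) (α : ℝ) (l i : Fin L) :
    Matrix (Fin N) (Fin K) ℂ :=
  (α : ℂ) • s.prevChannel β l i + s.innov i

/-- The received pilot signal `√p_tr ∑_i G_{li}[n-1] Ψ + Z`. -/
def receivedPilots (β : Fin L → Fin L → ℕ → ℝ) (p : ℝ) (l : Fin L)
    (Ψ : Matrix (Fin K) (Fin τ) ℂ) : Matrix (Fin N) (Fin τ) ℂ :=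
  ((Real.sqrt (pTr p τ) : ℝ) : ℂ) • (∑ i, s.prevChannel β l i * Ψ) + s.noise

/-- The MMSE channel estimate `Ĝ_{li}[n-1]`: the received pilots are correlated with the pilots,
divided by `√p_tr`, and column `k` is multiplied by
`β_{lik} (1 / p_tr + ∑_j β_{ljk})⁻¹`. -/
def estimate (β : Fin L → Fin L → ℕ → ℝ) (p : ℝ) (l : Fin L)
    (Ψ : Matrix (Fin K) (Fin τ) ℂ) (i : Fin L) : Matrix (Fin N) (Fin K) ℂ :=
  Matrix.of fun a k =>
    ((β l i k * (1 / pTr p τ + ∑ j, β l j k)⁻¹ * (Real.sqrt (pTr p τ))⁻¹ : ℝ) : ℂ) *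
      (s.receivedPilots β p l Ψ * Ψᴴ) a k

/-- The error matrix `Ẽ_{li}[n] = G_{li}[n] - α Ĝ_{li}[n-1]`. -/
def errorMatrix (β : Fin L → Fin L → ℕ → ℝ) (α p : ℝ) (l : Fin L)
    (Ψ : Matrix (Fin K) (Fin τ) ℂ) (i : Fin L) : Matrix (Fin N) (Fin K) ℂ :=
  s.currChannel β α l i - (α : ℂ) • s.estimate β p l Ψ i

/-- Row `k` of the zero-forcing matrix `Ĝ_{ll}[n-1]†`. -/
def zfRow (β : Fin L → Fin L → ℕ → ℝ) (p : ℝ) (l : Fin L)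
    (Ψ : Matrix (Fin K) (Fin τ) ℂ) (k : Fin K) : Fin N → ℂ :=
  pinv (s.estimate β p l Ψ l) k

/-- The uplink SINR `γ_k` of user `k` of cell `l` with zero-forcing decoding. -/
def sinr (β : Fin L → Fin L → ℕ → ℝ) (α p : ℝ) (l : Fin L)
    (Ψ : Matrix (Fin K) (Fin τ) ℂ) (k : Fin K) : ℝ :=
  α ^ 2 * p /
    (α ^ 2 * p * (∑ i ∈ Finset.univ.erase l,
        normSq (s.zfRow β p l Ψ k ᵥ* s.estimate β p l Ψ i))
      + p * (∑ i, normSq (s.zfRow β p l Ψ k ᵥ* s.errorMatrix β α p l Ψ i))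
      + normSq (s.zfRow β p l Ψ k))

end Sample

end ZFUplink

end

namespace ZFUplink

/-! All cells share the pilots, so every `Ĝ_{li}` is `Ĝ_{ll}` with column `k` scaled by
`β_{lik}/β_{llk}`. Once `Ĝ_{ll}` has full column rank, its pseudo-inverse is a left inverse, and the
contamination term of the SINR is exactly the constant `C` (`normSq_zfRow_vecMul_estimate`).
Dividing numerator and denominator by `p K ‖w_k‖²` gives `γ_k = α² u / (α² C u + x)` with `u = 1 /
(K ‖w_k‖²)` and `x = ∑_i ‖w_k Ẽ_{li}‖² / (K ‖w_k‖²) + 1 / (p K)`.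

Two conditional concentration bounds control `u` and `x`. First, `1/‖w_k‖²` is the squared distance
of column `k` of `Ĝ_{ll}` to the span of the other columns (`inv_normSq_pinv`). Given those columns
it is a sum of `N - K + 1` independent exponential variables of mean `β̂_{llk}`, so `u` is close to
`β̂_{llk}(κ - 1)`. Second, the MMSE coefficients make `Ẽ_{li}` uncorrelated with `Ĝ_{ll}`, hence
independent of it by Gaussianity (`hasLaw_jointVec`). Given `Ĝ_{ll}`, the quotient `‖w_k Ẽ_{li}‖² /
‖w_k‖²` is a sum of `K` independent exponential variables with total mean `Tr D̃_{li}`.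

Chernoff bounds make the deviations exponentially small in `K`, and `K` at stage `m` is at least
`m`. Borel–Cantelli therefore applies whatever the dependence between the stages. Assumption (a) or
(b) keeps the limiting denominator away from `0`, and `tendsto_quotient_sub_quotient` transfers the
convergence to the SINR. -/

/-! ### Complex Gaussian laws and their linear mixtures. -/

instance instIsProbabilityMeasureComplexGaussian (v : NNReal) :
    IsProbabilityMeasure (complexGaussian v) := by
  unfold complexGaussian
  exact Measure.isProbabilityMeasure_map (by fun_prop)

theorem charFun_complexGaussian (v : NNReal) (t : ℂ) :
    charFun (complexGaussian v) t = Complex.exp (-(v * ‖t‖ ^ 2 / 4 : ℝ)) := by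
  have h1 : ∀ q : ℝ × ℝ,
      Complex.exp ((inner ℝ (Complex.measurableEquivRealProd.symm q) t : ℝ) * Complex.I)
        = Complex.exp ((inner ℝ q.1 t.re : ℝ) * Complex.I)
          * Complex.exp ((inner ℝ q.2 t.im : ℝ) * Complex.I) := by
    intro q
    rw [← Complex.exp_add, ← add_mul, ← Complex.ofReal_add]
    congr 3
    simp [Complex.inner, Complex.measurableEquivRealProd]
  rw [charFun, complexGaussian, integral_map_equiv]
  simp_rw [h1]
  rw [integral_prod_mul (μ := gaussianReal 0 (v / 2)) (ν := gaussianReal 0 (v / 2))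
    (fun x : ℝ => Complex.exp ((inner ℝ x t.re : ℝ) * Complex.I))
    (fun x : ℝ => Complex.exp ((inner ℝ x t.im : ℝ) * Complex.I))]
  have h2 := charFun_gaussianReal (μ := 0) (v := v / 2)
  simp only [charFun] at h2
  rw [h2, h2, ← Complex.exp_add]
  congr 1
  rw [← Complex.normSq_eq_norm_sq, Complex.normSq_apply]
  push_cast
  ring

/-- A linear mixture of independent complex Gaussians whose coefficient vectors are orthogonal
consists again of independent complex Gaussians. -/
theorem measurePreserving_mixing {ι J : Type*} [Fintype ι] [Fintype J] [DecidableEq J]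
    (v : ι → NNReal) (s : J → NNReal) (a : J → ι → ℂ)
    (h : ∀ j j', ∑ x, a j x * star (a j' x) * (v x : ℝ) = if j = j' then ((s j : ℝ) : ℂ) else 0) :
    MeasurePreserving (fun (z : ι → ℂ) j => ∑ x, a j x * z x)
      (Measure.pi fun x => complexGaussian (v x)) (Measure.pi fun j => complexGaussian (s j)) := by
  have hm : Measurable (fun (z : ι → ℂ) j => ∑ x, a j x * z x) := by fun_prop
  refine ⟨hm, ?_⟩
  have : IsProbabilityMeasure ((Measure.pi fun x => complexGaussian (v x)).map
      (fun (z : ι → ℂ) j => ∑ x, a j x * z x)) := Measure.isProbabilityMeasure_map hm.aemeasurable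
  refine charFun_eq_pi_iff.1 fun t => ?_
  -- With `a` read as a matrix, the characteristic function of `a z` at `t` is that of `z` at `r =
  -- aᴴ t`.
  set r : PiLp 2 (fun _ : ι => ℂ) := WithLp.toLp 2 (fun x => ∑ j, star (a j x) * t j) with hr
  have h1 : charFun (((Measure.pi fun x => complexGaussian (v x)).map
      (fun (z : ι → ℂ) j => ∑ x, a j x * z x)).map (WithLp.toLp 2)) t
      = charFun ((Measure.pi fun x => complexGaussian (v x)).map (WithLp.toLp 2)) r := by
    have e1 := fun (ν : Measure (J → ℂ)) (f : PiLp 2 (fun _ : J => ℂ) → ℂ) =>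
      integral_map_equiv (μ := ν) (MeasurableEquiv.toLp 2 (J → ℂ)) f
    have e2 := fun (ν : Measure (ι → ℂ)) (f : PiLp 2 (fun _ : ι => ℂ) → ℂ) =>
      integral_map_equiv (μ := ν) (MeasurableEquiv.toLp 2 (ι → ℂ)) f
    simp only [MeasurableEquiv.coe_toLp] at e1 e2
    rw [charFun, charFun, e1, e2, integral_map hm.aemeasurable]
    · refine integral_congr_ae (ae_of_all _ fun z => ?_)
      simp only [PiLp.inner_apply, hr, Complex.inner]
      congr 3
      rw [← Complex.re_sum, ← Complex.re_sum]
      congr 1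
      simp_rw [map_sum, Finset.sum_mul, Finset.mul_sum]
      rw [Finset.sum_comm]
      refine Finset.sum_congr rfl fun x _ => Finset.sum_congr rfl fun j _ => ?_
      simp
      ring
    · refine Continuous.aestronglyMeasurable ?_
      fun_prop
  rw [h1, charFun_pi]
  simp_rw [charFun_complexGaussian, ← Complex.exp_sum]
  congr 1
  -- The quadratic form in the exponent is that of the covariance matrix of `a z`. It is diagonal by
  -- `h`, so the characteristic function factorises.
  have h2 : ∑ x, ((‖r x‖ ^ 2 : ℝ) : ℂ) * (v x : ℝ) = ∑ j, ((s j : ℝ) : ℂ) * (‖t j‖ ^ 2 : ℝ) := by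
    calc ∑ x, ((‖r x‖ ^ 2 : ℝ) : ℂ) * (v x : ℝ)
        = ∑ x, ∑ j, ∑ j', (t j * star (t j')) * star (a j x * star (a j' x) * (v x : ℝ)) := by
          refine Finset.sum_congr rfl fun x _ => ?_
          rw [Complex.ofReal_pow, ← Complex.mul_conj', hr]
          simp only [map_sum, Finset.sum_mul, Finset.mul_sum]
          rw [Finset.sum_comm]
          refine Finset.sum_congr rfl fun j _ => Finset.sum_congr rfl fun j' _ => ?_
          simp
          ring
      _ = ∑ j, ∑ j', (t j * star (t j')) * star (∑ x, a j x * star (a j' x) * (v x : ℝ)) := by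
          rw [Finset.sum_comm]
          refine Finset.sum_congr rfl fun j _ => ?_
          rw [Finset.sum_comm]
          refine Finset.sum_congr rfl fun j' _ => ?_
          rw [star_sum, Finset.mul_sum]
      _ = _ := by
          refine Finset.sum_congr rfl fun j _ => ?_
          simp_rw [h]
          rw [Finset.sum_eq_single j (by intro b _ hb; simp [hb.symm]) (by simp)]
          rw [if_pos rfl, Complex.ofReal_pow, ← Complex.mul_conj']
          simp
          ring
  have h3 : ∀ c d : ℂ, c = d → -(c / 4) = -(d / 4) := by rintro c d rfl; rfl
  simp only [Complex.ofReal_div, Complex.ofReal_mul, Finset.sum_neg_distrib, ← Finset.sum_div]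
  refine h3 _ _ ?_
  rw [← h2]
  exact Finset.sum_congr rfl fun x _ => mul_comm _ _

/-! ### Conditioning in product measures by resampling. -/

/-- Resampling the coordinates that satisfy `p` does not change a product measure. -/
theorem measurePreserving_resample {J : Type*} [Fintype J] (p : J → Prop) [DecidablePred p]
    (μ : J → Measure ℂ) [∀ j, IsProbabilityMeasure (μ j)] :
    MeasurePreserving (fun (q : (J → ℂ) × (J → ℂ)) j => if p j then q.2 j else q.1 j)
      ((Measure.pi μ).prod (Measure.pi μ)) (Measure.pi μ) := by
  have hm : Measurable (fun (q : (J → ℂ) × (J → ℂ)) j => if p j then q.2 j else q.1 j) := by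
    refine measurable_pi_lambda _ fun j => ?_
    split_ifs <;> fun_prop
  refine ⟨hm, (Measure.pi_eq fun s hs => ?_).symm⟩
  rw [Measure.map_apply hm (MeasurableSet.univ_pi hs)]
  have : (fun (q : (J → ℂ) × (J → ℂ)) j => if p j then q.2 j else q.1 j) ⁻¹' Set.univ.pi s
      = (Set.univ.pi fun j => if p j then Set.univ else s j) ×ˢ
        (Set.univ.pi fun j => if p j then s j else Set.univ) := by
    ext q
    simp only [Set.mem_preimage, Set.mem_pi, Set.mem_univ, true_imp_iff, Set.mem_prod,
      ← forall_and]
    refine forall_congr' fun j => ?_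
    split_ifs <;> simp
  rw [this, Measure.prod_prod, Measure.pi_pi, Measure.pi_pi, ← Finset.prod_mul_distrib]
  refine Finset.prod_congr rfl fun j _ => ?_
  split_ifs <;> simp

/-- A conditional bound on the probability of an event, given the coordinates outside `p`, is a
bound on its probability. -/
theorem measure_pi_le_of_resample {J : Type*} [Fintype J] (p : J → Prop) [DecidablePred p]
    (μ : J → Measure ℂ) [∀ j, IsProbabilityMeasure (μ j)] {A : Set (J → ℂ)}
    (hA : MeasurableSet A) (q : ENNReal)
    (h : ∀ x : J → ℂ, Measure.pi μ {z | (fun j => if p j then z j else x j) ∈ A} ≤ q) :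
    Measure.pi μ A ≤ q := by
  have hr := measurePreserving_resample p μ
  rw [← hr.measure_preimage hA.nullMeasurableSet, Measure.prod_apply (hr.measurable hA)]
  calc _ ≤ ∫⁻ _, q ∂(Measure.pi μ) := lintegral_mono fun x => h x
    _ = q := by simp

/-! ### Exponential moments and concentration of squared moduli. -/

theorem integral_exp_mul_sq_gaussianReal (w : NNReal) {s : ℝ} (hs : 2 * w * s < 1) :
    ∫ x, Real.exp (s * x ^ 2) ∂(gaussianReal 0 w) = (Real.sqrt (1 - 2 * w * s))⁻¹ := by
  rcases eq_or_ne w 0 with rfl | hw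
  · simp
  have hw' : (0 : ℝ) < w := by positivity
  have hb : 0 < 1 / (2 * (w : ℝ)) - s := by
    rw [sub_pos, lt_div_iff₀ (by positivity)]
    linarith
  rw [integral_gaussianReal_eq_integral_smul hw]
  have h1 : ∀ x : ℝ, gaussianPDFReal 0 w x • Real.exp (s * x ^ 2)
      = (Real.sqrt (2 * Real.pi * w))⁻¹ * Real.exp (-(1 / (2 * (w : ℝ)) - s) * x ^ 2) := by
    intro x
    rw [gaussianPDFReal, smul_eq_mul, mul_assoc, ← Real.exp_add]
    congr 2
    field_simp
    ring
  simp_rw [h1]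
  rw [integral_const_mul, integral_gaussian, ← Real.sqrt_inv, ← Real.sqrt_inv,
    ← Real.sqrt_mul (by positivity)]
  congr 1
  field_simp

/-- `‖z‖²` is an exponential variable of mean `v`: the real and imaginary parts each contribute a
factor `(1 - s v)^(-1/2)`. -/
theorem integral_exp_mul_sq_complexGaussian (v : NNReal) {s : ℝ} (hs : s * v < 1) :
    ∫ z, Real.exp (s * ‖z‖ ^ 2) ∂(complexGaussian v) = (1 - s * v)⁻¹ := by
  have h1 : ∀ q : ℝ × ℝ, Real.exp (s * ‖Complex.measurableEquivRealProd.symm q‖ ^ 2)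
        = Real.exp (s * q.1 ^ 2) * Real.exp (s * q.2 ^ 2) := by
    intro q
    rw [← Real.exp_add, ← Complex.normSq_eq_norm_sq, Complex.normSq_apply]
    congr 1
    simp [Complex.measurableEquivRealProd]
    ring
  have h2 : 2 * ((v / 2 : NNReal) : ℝ) * s = s * v := by
    push_cast
    ring
  rw [complexGaussian, integral_map_equiv]
  simp_rw [h1]
  rw [integral_prod_mul (μ := gaussianReal 0 (v / 2)) (ν := gaussianReal 0 (v / 2))
    (fun x : ℝ => Real.exp (s * x ^ 2)) (fun x : ℝ => Real.exp (s * x ^ 2)),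
    integral_exp_mul_sq_gaussianReal _ (by rw [h2]; exact hs), h2, ← mul_inv,
    Real.mul_self_sqrt (by linarith)]

/-- The logarithm of the left side is `-x - log (1 - x)`, which the Taylor remainder bounds by `x² /
(1 - |x|) ≤ 2 x²`. The left side is the moment generating function of a centred exponential
variable. -/
theorem exp_neg_mul_inv_one_sub_le {x : ℝ} (hx : |x| ≤ 1 / 2) :
    Real.exp (-x) * (1 - x)⁻¹ ≤ Real.exp (2 * x ^ 2) := by
  have h := Real.abs_log_sub_add_sum_range_le (show |x| < 1 by linarith) 1
  have h1 : 0 < 1 - x := by linarith [le_abs_self x]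
  have h2 : |x| ^ 2 / (1 - |x|) ≤ 2 * x ^ 2 := by
    rw [div_le_iff₀ (by linarith), sq_abs]
    nlinarith [sq_nonneg x]
  simp only [Finset.sum_range_one, zero_add, pow_one, Nat.cast_zero, div_one, one_add_one_eq_two]
    at h
  have h3 := (abs_le.1 (h.trans h2)).1
  calc Real.exp (-x) * (1 - x)⁻¹ = Real.exp (-x - Real.log (1 - x)) := by
        rw [Real.exp_sub, Real.exp_log h1, div_eq_mul_inv]
    _ ≤ _ := Real.exp_le_exp.2 (by linarith)

theorem integral_exp_sum_sq_complexGaussian_le {J : Type*} [Fintype J] (d : J → NNReal) {B : ℝ}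
    (hd : ∀ j, d j ≤ B) (s : ℝ) (hs : |s| * B ≤ 1 / 2) :
    Integrable (fun z : J → ℂ => Real.exp (s * ∑ j, (‖z j‖ ^ 2 - d j)))
      (Measure.pi fun j => complexGaussian (d j)) ∧
    ∫ z : J → ℂ, Real.exp (s * ∑ j, (‖z j‖ ^ 2 - d j))
      ∂(Measure.pi fun j => complexGaussian (d j))
        ≤ Real.exp (2 * s ^ 2 * B ^ 2 * Fintype.card J) := by
  have hsd : ∀ j, |s * d j| ≤ 1 / 2 := fun j => by
    rw [abs_mul, NNReal.abs_eq]
    exact (mul_le_mul_of_nonneg_left (hd j) (abs_nonneg s)).trans hs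
  have h1 : ∀ z : J → ℂ, Real.exp (s * ∑ j, (‖z j‖ ^ 2 - d j))
      = ∏ j, Real.exp (-(s * d j)) * Real.exp (s * ‖z j‖ ^ 2) := by
    intro z
    rw [Finset.mul_sum, Real.exp_sum]
    refine Finset.prod_congr rfl fun j _ => ?_
    rw [← Real.exp_add]
    congr 1
    ring
  have h2 : ∫ z : J → ℂ, Real.exp (s * ∑ j, (‖z j‖ ^ 2 - d j))
      ∂(Measure.pi fun j => complexGaussian (d j))
        = ∏ j, Real.exp (-(s * d j)) * (1 - s * d j)⁻¹ := by
    simp_rw [h1]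
    rw [integral_fintype_prod_eq_prod (μ := fun j => complexGaussian (d j))
      (fun j z => Real.exp (-(s * d j)) * Real.exp (s * ‖z‖ ^ 2))]
    refine Finset.prod_congr rfl fun j _ => ?_
    rw [integral_const_mul, integral_exp_mul_sq_complexGaussian]
    linarith [le_abs_self (s * d j), hsd j]
  have hpos : ∀ j, 0 < 1 - s * d j := fun j => by linarith [le_abs_self (s * d j), hsd j]
  refine ⟨?_, ?_⟩
  -- The integral of a non-integrable function is `0` by convention, whereas the product computed in
  -- `h2` is positive.
  · by_contra hcon
    rw [integral_undef hcon] at h2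
    have : 0 < ∏ j, Real.exp (-(s * d j)) * (1 - s * d j)⁻¹ :=
      Finset.prod_pos fun j _ => mul_pos (Real.exp_pos _) (inv_pos.2 (hpos j))
    exact this.ne h2
  · rw [h2]
    calc ∏ j, Real.exp (-(s * d j)) * (1 - s * d j)⁻¹
        ≤ ∏ _j : J, Real.exp (2 * s ^ 2 * B ^ 2) := by
          refine Finset.prod_le_prod
            (fun j _ => (mul_pos (Real.exp_pos _) (inv_pos.2 (hpos j))).le) fun j _ => ?_
          refine (exp_neg_mul_inv_one_sub_le (hsd j)).trans (Real.exp_le_exp.2 ?_)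
          rw [mul_pow, mul_assoc]
          gcongr
          exact hd j
      _ = _ := by
          rw [Finset.prod_const, ← Real.exp_nat_mul, Finset.card_univ]
          congr 1
          ring

/-- Exponential concentration of a weighted sum of independent exponential variables. -/
theorem measure_abs_sum_sq_complexGaussian_ge_le {J : Type*} [Fintype J] (d : J → NNReal) {B : ℝ}
    (hd : ∀ j, d j ≤ B) {s : ℝ} (hs0 : 0 ≤ s) (hs : s * B ≤ 1 / 2) (t : ℝ) :
    (Measure.pi fun j => complexGaussian (d j)) {z : J → ℂ | t ≤ |∑ j, (‖z j‖ ^ 2 - d j)|}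
      ≤ ENNReal.ofReal (2 * Real.exp (-(s * t) + 2 * s ^ 2 * B ^ 2 * Fintype.card J)) := by
  -- Chernoff with `s` for the upper tail and `-s` for the lower one. The parameter stays free until
  -- `exists_exponential_rate`.
  have hs1 : |s| * B ≤ 1 / 2 := by rwa [abs_of_nonneg hs0]
  have hs2 : |-s| * B ≤ 1 / 2 := by rwa [abs_neg]
  obtain ⟨i1, b1⟩ := integral_exp_sum_sq_complexGaussian_le d hd s hs1
  obtain ⟨i2, b2⟩ := integral_exp_sum_sq_complexGaussian_le d hd (-s) hs2
  have c1 := measure_ge_le_exp_mul_mgf t hs0 i1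
  have c2 := measure_le_le_exp_mul_mgf (-t) (neg_nonpos.2 hs0) i2
  rw [mgf] at c1 c2
  have d1 := c1.trans (mul_le_mul_of_nonneg_left b1 (Real.exp_pos _).le)
  have d2 := c2.trans (mul_le_mul_of_nonneg_left b2 (Real.exp_pos _).le)
  rw [← Real.exp_add, neg_mul] at d1
  rw [← Real.exp_add, neg_neg, mul_neg, neg_sq] at d2
  set μ := Measure.pi fun j => complexGaussian (d j)
  have hsub : {z : J → ℂ | t ≤ |∑ j, (‖z j‖ ^ 2 - d j)|}
      ⊆ {z | t ≤ ∑ j, (‖z j‖ ^ 2 - d j)} ∪ {z | ∑ j, (‖z j‖ ^ 2 - d j) ≤ -t} := by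
    intro z hz
    rcases le_abs.1 (Set.mem_ofPred_eq ▸ hz) with h | h
    · exact Or.inl h
    · exact Or.inr (by simp only [Set.mem_ofPred_eq]; linarith)
  rw [← ofReal_measureReal]
  refine ENNReal.ofReal_le_ofReal ?_
  calc μ.real _ ≤ _ := measureReal_mono hsub
    _ ≤ _ := measureReal_union_le _ _
    _ ≤ _ := by linarith

/-! ### Geometry of the pseudo-inverse. -/

/-- Column `k` of a matrix as a vector of the Euclidean space. -/
def euclCol {N K : ℕ} (A : Matrix (Fin N) (Fin K) ℂ) (k : Fin K) : EuclideanSpace ℂ (Fin N) :=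
  WithLp.toLp 2 fun a => A a k

/-- The span of all the columns of a matrix but one. -/
def otherSpan {N K : ℕ} (A : Matrix (Fin N) (Fin K) ℂ) (k : Fin K) :
    Submodule ℂ (EuclideanSpace ℂ (Fin N)) :=
  Submodule.span ℂ (euclCol A '' (Set.univ \ {k}))

open scoped ComplexOrder in
-- Full column rank is expressed through the Gram determinant because the latter is continuous in
-- the entries, which makes the rank event measurable.
theorem gram_det_ne_zero_of_linearIndependent {N K : ℕ} {A : Matrix (Fin N) (Fin K) ℂ}
    (h : LinearIndependent ℂ (euclCol A)) : (Aᴴ * A).det ≠ 0 := by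
  rw [← isUnit_iff_ne_zero, ← Matrix.isUnit_iff_isUnit_det]
  refine Matrix.mulVec_injective_iff_isUnit.1 ?_
  have h1 : Function.Injective A.mulVec := by
    rw [Matrix.mulVec_injective_iff]
    have := h.map' (WithLp.linearEquiv 2 ℂ (Fin N → ℂ)).toLinearMap (LinearEquiv.ker _)
    exact this
  intro x y hxy
  have h2 : (Aᴴ * A) *ᵥ (x - y) = 0 := by
    rw [Matrix.mulVec_sub]
    exact sub_eq_zero.2 hxy
  rw [Matrix.conjTranspose_mul_self_mulVec_eq_zero, Matrix.mulVec_sub, sub_eq_zero] at h2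
  exact h1 h2

theorem linearIndependent_of_gram_det_ne_zero {N K : ℕ} {A : Matrix (Fin N) (Fin K) ℂ}
    (h : (Aᴴ * A).det ≠ 0) : LinearIndependent ℂ (euclCol A) := by
  have h1 : LinearIndependent ℂ A.col := by
    rw [← Matrix.mulVec_injective_iff]
    intro x y hxy
    rw [← isUnit_iff_ne_zero, ← Matrix.isUnit_iff_isUnit_det] at h
    refine Matrix.mulVec_injective_iff_isUnit.2 h ?_
    simp only [← Matrix.mulVec_mulVec]
    exact congrArg _ hxy
  exact h1.map' (WithLp.linearEquiv 2 ℂ (Fin N → ℂ)).symm.toLinearMap (LinearEquiv.ker _)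

theorem pinv_mul_self {N K : ℕ} {A : Matrix (Fin N) (Fin K) ℂ} (h : (Aᴴ * A).det ≠ 0) :
    pinv A * A = 1 := by
  have hu := isUnit_iff_ne_zero.2 h
  have h1 : Aᴴ * A * (pinv A * A) = Aᴴ * A := by
    rw [Matrix.mul_assoc, ← Matrix.mul_assoc A, (pinv_spec A).mul_mul_left]
  calc pinv A * A = (Aᴴ * A)⁻¹ * (Aᴴ * A * (pinv A * A)) := by
        rw [← Matrix.mul_assoc, Matrix.nonsing_inv_mul _ hu, Matrix.one_mul]
    _ = 1 := by rw [h1, Matrix.nonsing_inv_mul _ hu]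

/-- `pinv` is defined by choice. This explicit formula is what gives access to measurability on the
full-rank event. -/
theorem pinv_eq_gram_inv_mul {N K : ℕ} {A : Matrix (Fin N) (Fin K) ℂ} (h : (Aᴴ * A).det ≠ 0) :
    pinv A = (Aᴴ * A)⁻¹ * Aᴴ := by
  have hu := isUnit_iff_ne_zero.2 h
  have h1 : Aᴴ * (A * pinv A) = Aᴴ := by
    calc Aᴴ * (A * pinv A) = (A * pinv A * A)ᴴ := by
          rw [conjTranspose_mul, (pinv_spec A).herm_left]
      _ = Aᴴ := by rw [(pinv_spec A).mul_mul_left]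
  calc pinv A = (Aᴴ * A)⁻¹ * (Aᴴ * A) * pinv A := by
        rw [Matrix.nonsing_inv_mul _ hu, Matrix.one_mul]
    _ = (Aᴴ * A)⁻¹ * (Aᴴ * (A * pinv A)) := by simp only [Matrix.mul_assoc]
    _ = _ := by rw [h1]

/-- The other `K - 1` columns span at most `K - 1` dimensions, exactly that many when independent.
The complement then has dimension `N - K + 1`, the number of degrees of freedom in the concentration
bound. -/
theorem finrank_otherSpan_orthogonal {N K : ℕ} (A : Matrix (Fin N) (Fin K) ℂ) (k : Fin K) :
    N + 1 ≤ Module.finrank ℂ (otherSpan A k)ᗮ + K ∧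
      ((Aᴴ * A).det ≠ 0 → Module.finrank ℂ (otherSpan A k)ᗮ + K = N + 1) := by
  have h1 := Submodule.finrank_add_finrank_orthogonal (otherSpan A k)
  rw [finrank_euclideanSpace_fin] at h1
  have h2 : Fintype.card {j : Fin K // j ≠ k} + 1 = K := by
    rw [Fintype.card_subtype_compl, Fintype.card_fin, Fintype.card_subtype_eq]
    have := k.pos
    omega
  have h3 : otherSpan A k
      = Submodule.span ℂ (Set.range fun j : {j : Fin K // j ≠ k} => euclCol A j) := by
    unfold otherSpan
    congr 1
    ext x
    simp
  constructor
  · have : Module.finrank ℂ (otherSpan A k) ≤ Fintype.card {j : Fin K // j ≠ k} := by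
      rw [h3]
      exact finrank_range_le_card _
    omega
  · intro h
    have : Module.finrank ℂ (otherSpan A k) = Fintype.card {j : Fin K // j ≠ k} := by
      rw [h3]
      exact finrank_span_eq_card
        ((linearIndependent_of_gram_det_ne_zero h).comp _ Subtype.val_injective)
    omega

/-- Row `k` of the pseudo-inverse of a matrix of full column rank has the norm of the inverse of
the distance of column `k` to the span of the other columns. -/
theorem inv_normSq_pinv {N K : ℕ} {A : Matrix (Fin N) (Fin K) ℂ} (h : (Aᴴ * A).det ≠ 0)
    (k : Fin K) :
    (normSq (pinv A k))⁻¹ = ∑ i, ‖∑ a, star ((stdOrthonormalBasis ℂ (otherSpan A k)ᗮ i :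
      EuclideanSpace ℂ (Fin N)) a) * A a k‖ ^ 2 := by
  set V := otherSpan A k with hV
  set v : EuclideanSpace ℂ (Fin N) := WithLp.toLp 2 (fun a => star (pinv A k a)) with hv
  have hnv : normSq (pinv A k) = ‖v‖ ^ 2 := by
    simp [normSq, hv, EuclideanSpace.norm_sq_eq]
  have hin : ∀ j, inner ℂ v (euclCol A j) = if k = j then 1 else 0 := by
    intro j
    rw [← Matrix.one_apply, ← pinv_mul_self h, Matrix.mul_apply]
    simp [PiLp.inner_apply, euclCol, hv, mul_comm]
  have hvV : v ∈ Vᗮ := by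
    rw [Submodule.mem_orthogonal']
    intro u hu
    induction hu using Submodule.span_induction with
    | mem x hx =>
      obtain ⟨j, hj, rfl⟩ := hx
      rw [hin, if_neg]
      rintro rfl
      exact hj.2 rfl
    | zero => simp
    | add x y _ _ hx hy => rw [inner_add_right, hx, hy, add_zero]
    | smul c x _ hx => rw [inner_smul_right, hx, mul_zero]
  -- The conjugated row lies in the column space, since `(A†)ᴴ = A (A† (A†)ᴴ)`.
  obtain ⟨g, hg⟩ : ∃ g : Fin K → ℂ, v = ∑ j, g j • euclCol A j := by
    refine ⟨fun j => (pinv A * (pinv A)ᴴ) j k, ?_⟩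
    have : (pinv A)ᴴ = A * (pinv A * (pinv A)ᴴ) := by
      conv_lhs => rw [← (pinv_spec A).mul_mul_right, Matrix.mul_assoc, conjTranspose_mul,
        (pinv_spec A).herm_left, Matrix.mul_assoc]
    ext a
    have h2 := congrFun (congrFun this a) k
    rw [Matrix.mul_apply] at h2
    simpa [hv, euclCol, mul_comm] using h2
  -- Projecting `v = ∑ g_j a_j` onto `Vᗮ` kills every term but `g_k r`. Pairing with `a_k` gives
  -- `conj(g_k) ‖r‖² = 1`, and so `‖v‖² = |g_k|² ‖r‖² = 1/‖r‖²`.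
  set r := Vᗮ.orthogonalProjectionOnto (euclCol A k) with hr
  have hvr : (⟨v, hvV⟩ : Vᗮ) = g k • r := by
    have h1 : Vᗮ.orthogonalProjectionOnto v = ⟨v, hvV⟩ :=
      Submodule.orthogonalProjectionOnto_mem_subspace_eq_self ⟨v, hvV⟩
    rw [← h1]
    conv_lhs => rw [hg]
    rw [map_sum, Finset.sum_eq_single k, map_smul]
    · intro j _ hj
      rw [map_smul, Submodule.orthogonalProjectionOnto_orthogonal_apply_eq_zero, smul_zero]
      exact Submodule.subset_span ⟨j, ⟨trivial, hj⟩, rfl⟩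
    · simp
  have hone : star (g k) * (‖r‖ ^ 2 : ℝ) = 1 := by
    have h1 := hin k
    rw [if_pos rfl, ← Submodule.inner_orthogonalProjectionOnto_eq_of_mem_left ⟨v, hvV⟩, ← hr, hvr,
      inner_smul_left, inner_self_eq_norm_sq_to_K] at h1
    simpa using h1
  have hnorm : ‖v‖ ^ 2 = ‖g k‖ ^ 2 * ‖r‖ ^ 2 := by
    have : ‖(⟨v, hvV⟩ : Vᗮ)‖ = ‖g k‖ * ‖r‖ := by rw [hvr, norm_smul]
    rw [← mul_pow, ← this]
    rfl
  have hone' : ‖g k‖ * ‖r‖ ^ 2 = 1 := by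
    have := congrArg norm hone
    rw [norm_mul, norm_star, Complex.norm_real, norm_one, Real.norm_of_nonneg (by positivity)]
      at this
    exact this
  have hfin : (‖v‖ ^ 2)⁻¹ = ‖r‖ ^ 2 := by
    refine inv_eq_of_mul_eq_one_right ?_
    rw [hnorm]
    calc _ = (‖g k‖ * ‖r‖ ^ 2) ^ 2 := by ring
      _ = 1 := by rw [hone', one_pow]
  rw [hnv, hfin, ← OrthonormalBasis.sum_sq_norm_inner_right (stdOrthonormalBasis ℂ Vᗮ) r]
  refine Finset.sum_congr rfl fun i _ => ?_
  rw [hr, Submodule.inner_orthogonalProjectionOnto_eq_of_mem_left]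
  simp [PiLp.inner_apply, euclCol, mul_comm]

/-! ### Gaussian matrices: full rank and concentration for rows of the pseudo-inverse. -/

/-- The matrix formed by the coordinates of a vector selected by `f`. -/
def blockMatrix {N K : ℕ} {J : Type*} (f : Fin N × Fin K → J) (z : J → ℂ) :
    Matrix (Fin N) (Fin K) ℂ :=
  Matrix.of fun a k => z (f (a, k))

/-- Coordinates of the columns of a Gaussian matrix along fixed directions which are orthonormal
within each column are independent complex Gaussians. -/
theorem measurePreserving_columnMixing {N K : ℕ} {J I : Type*} [Fintype J] [Fintype I]
    [DecidableEq I] {f : Fin N × Fin K → J} (hf : Function.Injective f) (d : J → NNReal)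
    {δ : Fin K → NNReal} (hd : ∀ a k, d (f (a, k)) = δ k) (c : I → Fin K) (e : I → Fin N → ℂ)
    (he : ∀ i i', c i = c i' → ∑ a, e i a * star (e i' a) = if i = i' then 1 else 0) :
    MeasurePreserving (fun (z : J → ℂ) i => ∑ a, e i a * blockMatrix f z a (c i))
      (Measure.pi fun j => complexGaussian (d j))
      (Measure.pi fun i => complexGaussian (δ (c i))) := by
  classical
  have h := measurePreserving_mixing d (fun i => δ (c i))
    (fun i x => ∑ a, if f (a, c i) = x then e i a else 0) ?_
  · convert h using 3 with z i
    simp_rw [Finset.sum_mul]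
    rw [Finset.sum_comm]
    refine Finset.sum_congr rfl fun a _ => ?_
    simp [blockMatrix]
  · intro i i'
    -- Different columns use disjoint coordinates, so orthonormality of the directions matters only
    -- within one column.
    have h1 : ∀ x, (∑ a, if f (a, c i) = x then e i a else 0)
        * star (∑ a, if f (a, c i') = x then e i' a else 0) * ((d x : ℝ) : ℂ)
        = ∑ a, if f (a, c i) = x then
            (if c i = c i' then e i a * star (e i' a) * ((δ (c i) : ℝ) : ℂ) else 0) else 0 := by
      intro x
      rw [Finset.sum_mul, Finset.sum_mul]
      refine Finset.sum_congr rfl fun a _ => ?_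
      by_cases hx : f (a, c i) = x
      · rw [if_pos hx, if_pos hx]
        subst hx
        rw [hd, star_sum]
        by_cases hc : c i = c i'
        · rw [if_pos hc, Finset.sum_eq_single a]
          · rw [if_pos (by rw [hc])]
          · intro b _ hb
            rw [if_neg, star_zero]
            intro hcon
            exact hb (congrArg Prod.fst (hf hcon))
          · simp
        · rw [if_neg hc, Finset.sum_eq_zero]
          · simp
          · intro b _
            rw [if_neg, star_zero]
            intro hcon
            exact hc (congrArg Prod.snd (hf hcon)).symm
      · simp [if_neg hx]
    simp_rw [h1]
    rw [Finset.sum_comm]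
    simp only [Finset.sum_ite_eq, Finset.mem_univ, if_true]
    by_cases hc : c i = c i'
    · simp only [if_pos hc]
      rw [← Finset.sum_mul, he i i' hc]
      split_ifs <;> simp
    · simp only [if_neg hc, Finset.sum_const_zero]
      rw [if_neg]
      rintro rfl
      exact hc rfl

theorem complexGaussian_singleton_zero {v : NNReal} (hv : v ≠ 0) : complexGaussian v {0} = 0 := by
  have : NullSingletonClass (gaussianReal 0 (v / 2)) :=
    nullSingletonClass_gaussianReal (by positivity)
  rw [complexGaussian, MeasurableEquiv.map_apply]
  have : (Complex.measurableEquivRealProd.symm : ℝ × ℝ → ℂ) ⁻¹' {0} = {0} ×ˢ {0} := by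
    ext ⟨x, y⟩
    simp [Complex.measurableEquivRealProd]
  rw [this, Measure.prod_prod, measure_singleton, zero_mul]

theorem continuous_euclCol_blockMatrix {N K : ℕ} {J : Type*} (f : Fin N × Fin K → J) (k : Fin K) :
    Continuous fun z : J → ℂ => euclCol (blockMatrix f z) k := by
  unfold euclCol blockMatrix
  simp only [Matrix.of_apply]
  fun_prop

theorem mem_otherSpan_iff {N K : ℕ} (A : Matrix (Fin N) (Fin K) ℂ) (k : Fin K)
    (x : EuclideanSpace ℂ (Fin N)) :
    x ∈ otherSpan A k ↔ ∃ g : Fin K → ℂ, ∑ j ∈ Finset.univ.erase k, g j • euclCol A j = x := by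
  have : (Set.univ \ {k} : Set (Fin K)) = ↑(Finset.univ.erase k) := by
    ext
    simp
  rw [otherSpan, this]
  rw [Submodule.mem_span_image_finset_iff_exists_fun]
  constructor
  · rintro ⟨c, hc⟩
    refine ⟨fun j => if h : j ∈ Finset.univ.erase k then c ⟨j, h⟩ else 0, ?_⟩
    rw [← hc, ← Finset.sum_coe_sort]
    exact Finset.sum_congr rfl fun j _ => by simp only [dif_pos j.2]
  · rintro ⟨g, hg⟩
    exact ⟨fun j => g j, (Finset.sum_coe_sort _ fun j => g j • euclCol A j).trans hg⟩

theorem otherSpan_congr {N K : ℕ} {A B : Matrix (Fin N) (Fin K) ℂ} {k : Fin K}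
    (h : ∀ j ≠ k, ∀ a, A a j = B a j) : otherSpan A k = otherSpan B k := by
  unfold otherSpan
  congr 1
  refine Set.image_congr fun j hj => ?_
  unfold euclCol
  congr 1
  funext a
  exact h j hj.2 a

/-- A column of a tall Gaussian matrix is almost surely not in the span of the others. -/
theorem ae_euclCol_notMem_otherSpan {N K : ℕ} (hNK : K ≤ N) {J : Type*} [Fintype J]
    {f : Fin N × Fin K → J} (hf : Function.Injective f) (d : J → NNReal)
    {δ : Fin K → NNReal} (hd : ∀ a k, d (f (a, k)) = δ k) (hδ : ∀ k, δ k ≠ 0) (k : Fin K) :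
    ∀ᵐ z ∂(Measure.pi fun j => complexGaussian (d j)),
      euclCol (blockMatrix f z) k ∉ otherSpan (blockMatrix f z) k := by
  classical
  -- A measurable superset of the event that column `k` lies in the span: coefficients from a
  -- countable dense set approximate the column arbitrarily well.
  set A : Set (J → ℂ) := {z | ∀ n : ℕ, ∃ m : ℕ, ‖euclCol (blockMatrix f z) k -
    ∑ j ∈ Finset.univ.erase k, TopologicalSpace.denseSeq (Fin K → ℂ) m j •
      euclCol (blockMatrix f z) j‖ < 1 / ((n : ℝ) + 1)} with hA
  have hcont := continuous_euclCol_blockMatrix (N := N) (K := K) f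
  have hAm : MeasurableSet A := by
    rw [hA]
    simp only [Set.ofPred_forall, Set.ofPred_exists]
    refine MeasurableSet.iInter fun n => MeasurableSet.iUnion fun m => ?_
    refine (isOpen_lt ?_ continuous_const).measurableSet
    fun_prop
  have hA0 : Measure.pi (fun j => complexGaussian (d j)) A ≤ 0 := by
    refine measure_pi_le_of_resample (fun j => ∃ a, f (a, k) = j) _ hAm 0 fun x => ?_
    set V := otherSpan (blockMatrix f x) k with hV
    -- With the other columns frozen, `K ≤ N` leaves a unit vector `u` normal to their span. The
    -- component of column `k` along `u` is a nondegenerate Gaussian, almost surely nonzero.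
    obtain ⟨u, hu, hu1⟩ : ∃ u ∈ Vᗮ, ‖u‖ = 1 := by
      have h1 : N + 1 ≤ Module.finrank ℂ Vᗮ + K :=
        (finrank_otherSpan_orthogonal (blockMatrix f x) k).1
      have h2 : 0 < Module.finrank ℂ Vᗮ := by omega
      exact ⟨stdOrthonormalBasis ℂ Vᗮ ⟨0, h2⟩, Submodule.coe_mem _,
        (stdOrthonormalBasis ℂ Vᗮ).orthonormal.1 _⟩
    have hmp := measurePreserving_columnMixing hf d hd (fun _ : Unit => k)
      (fun _ a => star (u a)) (by
        intro _ _ _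
        rw [if_pos rfl]
        have : inner ℂ u u = (1 : ℂ) := by rw [inner_self_eq_norm_sq_to_K, hu1]; simp
        rw [PiLp.inner_apply] at this
        rw [← this]
        refine Finset.sum_congr rfl fun a _ => ?_
        rw [star_star, mul_comm]
        rfl)
    have hnull : Measure.pi (fun _ : Unit => complexGaussian (δ k)) {y | y () = 0} = 0 := by
      have : {y : Unit → ℂ | y () = 0} = Set.univ.pi fun _ => {0} := by
        ext y
        simp [Unique.forall_iff]
      rw [this, Measure.pi_pi]
      simp [complexGaussian_singleton_zero (hδ k)]
    rw [← hnull, ← hmp.measure_preimage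
      (measurableSet_eq_fun (by fun_prop) measurable_const).nullMeasurableSet]
    refine measure_mono fun z hz => ?_
    set z' : J → ℂ := fun j => if ∃ a, f (a, k) = j then z j else x j with hz'
    have hother : ∀ j ≠ k, ∀ a, blockMatrix f z' a j = blockMatrix f x a j := by
      intro j hj a
      simp only [blockMatrix, Matrix.of_apply, hz']
      rw [if_neg]
      rintro ⟨b, hb⟩
      exact hj (congrArg Prod.snd (hf hb)).symm
    have hk : euclCol (blockMatrix f z') k = euclCol (blockMatrix f z) k := by
      unfold euclCol
      congr 1
      funext a
      simp only [blockMatrix, Matrix.of_apply, hz']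
      rw [if_pos ⟨a, rfl⟩]
    have hmem : euclCol (blockMatrix f z) k ∈ closure (V : Set (EuclideanSpace ℂ (Fin N))) := by
      refine Metric.mem_closure_iff.2 fun ε hε => ?_
      obtain ⟨n, hn⟩ := exists_nat_one_div_lt hε
      obtain ⟨m, hm⟩ := hz n
      refine ⟨∑ j ∈ Finset.univ.erase k, TopologicalSpace.denseSeq (Fin K → ℂ) m j •
          euclCol (blockMatrix f z') j, ?_, ?_⟩
      · rw [hV, ← otherSpan_congr hother]
        exact (mem_otherSpan_iff _ _ _).2 ⟨_, rfl⟩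
      · rw [dist_eq_norm, ← hk]
        exact hm.trans hn
    rw [IsClosed.closure_eq V.closed_of_finiteDimensional] at hmem
    have h0 := (Submodule.mem_orthogonal' _ _).1 hu _ hmem
    rw [PiLp.inner_apply] at h0
    change ∑ a, star (u a) * blockMatrix f z a k = 0
    rw [← h0]
    refine Finset.sum_congr rfl fun a _ => ?_
    simp [euclCol, mul_comm]
  have hA1 : ∀ᵐ z ∂(Measure.pi fun j => complexGaussian (d j)), z ∉ A :=
    measure_eq_zero_iff_ae_notMem.1 (le_antisymm hA0 zero_le)
  filter_upwards [hA1] with z hz hmem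
  refine hz fun n => ?_
  obtain ⟨g, hg⟩ := (mem_otherSpan_iff _ _ _).1 hmem
  set F : (Fin K → ℂ) → EuclideanSpace ℂ (Fin N) := fun g =>
    ∑ j ∈ Finset.univ.erase k, g j • euclCol (blockMatrix f z) j with hF
  have hFc : Continuous F := by fun_prop
  have hopen : IsOpen {g' : Fin K → ℂ | ‖euclCol (blockMatrix f z) k - F g'‖ < 1 / ((n : ℝ) + 1)} :=
    isOpen_lt (by fun_prop) continuous_const
  obtain ⟨m, hm⟩ := (TopologicalSpace.denseRange_denseSeq (Fin K → ℂ)).exists_mem_open hopen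
    ⟨g, by
      simp only [Set.mem_ofPred_eq, hF]
      rw [hg, sub_self, norm_zero]
      positivity⟩
  exact ⟨m, hm⟩

/-- A tall Gaussian matrix has almost surely full column rank. -/
theorem ae_gram_det_ne_zero {N K : ℕ} (hNK : K ≤ N) {J : Type*} [Fintype J]
    {f : Fin N × Fin K → J} (hf : Function.Injective f) (d : J → NNReal)
    {δ : Fin K → NNReal} (hd : ∀ a k, d (f (a, k)) = δ k) (hδ : ∀ k, δ k ≠ 0) :
    ∀ᵐ z ∂(Measure.pi fun j => complexGaussian (d j)),
      ((blockMatrix f z)ᴴ * blockMatrix f z).det ≠ 0 := by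
  have h := ae_all_iff.2 fun k => ae_euclCol_notMem_otherSpan hNK hf d hd hδ k
  filter_upwards [h] with z hz
  exact gram_det_ne_zero_of_linearIndependent (linearIndependent_iff_notMem_span.2 hz)

theorem normSq_eq_sum {n : ℕ} (v : Fin n → ℂ) : normSq v = ∑ a, ‖v a‖ ^ 2 := by
  rw [normSq, EuclideanSpace.norm_sq_eq]

theorem normSq_nonneg {n : ℕ} (v : Fin n → ℂ) : 0 ≤ normSq v := sq_nonneg _

theorem normSq_pinv_pos {N K : ℕ} {A : Matrix (Fin N) (Fin K) ℂ} (h : (Aᴴ * A).det ≠ 0)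
    (k : Fin K) : 0 < normSq (pinv A k) := by
  refine lt_of_le_of_ne (normSq_nonneg _) fun h0 => ?_
  have h1 : pinv A k = 0 := by
    rw [normSq, eq_comm, sq_eq_zero_iff, norm_eq_zero] at h0
    simpa using h0
  have h2 := congrFun (congrFun (pinv_mul_self h) k) k
  rw [Matrix.mul_apply, h1] at h2
  simp at h2

theorem continuous_blockMatrix {N K : ℕ} {J : Type*} (f : Fin N × Fin K → J) :
    Continuous (blockMatrix f) := by
  unfold blockMatrix
  exact continuous_matrix fun a k => continuous_apply _

theorem measurable_gram_det {N K : ℕ} {J : Type*} [Fintype J] (f : Fin N × Fin K → J) :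
    Measurable fun z : J → ℂ => ((blockMatrix f z)ᴴ * blockMatrix f z).det :=
  (((continuous_blockMatrix f).matrix_conjTranspose.matrix_mul
    (continuous_blockMatrix f)).matrix_det).measurable

/-- The inverse is the adjugate divided by the determinant. This also holds for a singular Gram
matrix, as both conventions give `0` there. -/
theorem measurable_gramInv_mul {N K : ℕ} {J : Type*} [Fintype J] (f : Fin N × Fin K → J)
    (k : Fin K) (a : Fin N) : Measurable fun z : J → ℂ =>
    (((blockMatrix f z)ᴴ * blockMatrix f z)⁻¹ * (blockMatrix f z)ᴴ) k a := by
  have h1 := continuous_blockMatrix f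
  have h2 : Continuous fun z : J → ℂ =>
      (((blockMatrix f z)ᴴ * blockMatrix f z).adjugate * (blockMatrix f z)ᴴ) k a :=
    (((h1.matrix_conjTranspose.matrix_mul h1).matrix_adjugate.matrix_mul
      h1.matrix_conjTranspose)).matrix_elem k a
  have h3 : ∀ z : J → ℂ, (((blockMatrix f z)ᴴ * blockMatrix f z)⁻¹ * (blockMatrix f z)ᴴ) k a
      = (((blockMatrix f z)ᴴ * blockMatrix f z).det)⁻¹ *
        (((blockMatrix f z)ᴴ * blockMatrix f z).adjugate * (blockMatrix f z)ᴴ) k a := by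
    intro z
    rw [Matrix.inv_def, Ring.inverse_eq_inv', Matrix.smul_mul, Matrix.smul_apply, smul_eq_mul]
  simp_rw [h3]
  exact (measurable_gram_det f).inv.mul h2.measurable

/-- Concentration of the inverse norm of a row of the pseudo-inverse of a Gaussian matrix. -/
theorem measure_inv_normSq_pinv_le {N K : ℕ} {J : Type*} [Fintype J]
    {f : Fin N × Fin K → J} (hf : Function.Injective f) (d : J → NNReal)
    {δ : Fin K → NNReal} (hd : ∀ a k, d (f (a, k)) = δ k) (k : Fin K) {B : ℝ} (hB : δ k ≤ B)
    {s : ℝ} (hs0 : 0 ≤ s) (hs : s * B ≤ 1 / 2) (t : ℝ) :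
    (Measure.pi fun j => complexGaussian (d j))
      {z | ((blockMatrix f z)ᴴ * blockMatrix f z).det ≠ 0 ∧
        t ≤ |(normSq (pinv (blockMatrix f z) k))⁻¹ - δ k * ((N : ℝ) + 1 - K)|}
      ≤ ENNReal.ofReal (2 * Real.exp (-(s * t) + 2 * s ^ 2 * B ^ 2 * ((N : ℝ) + 1 - K))) := by
  classical
  refine measure_pi_le_of_resample (fun j => ∃ a, f (a, k) = j) _ ?_ _ fun x => ?_
  · obtain ⟨R, hR⟩ : ∃ R : (J → ℂ) → Fin N → ℂ, R = fun z a =>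
      (((blockMatrix f z)ᴴ * blockMatrix f z)⁻¹ * (blockMatrix f z)ᴴ) k a := ⟨_, rfl⟩
    have hset : {z | ((blockMatrix f z)ᴴ * blockMatrix f z).det ≠ 0 ∧
          t ≤ |(normSq (pinv (blockMatrix f z) k))⁻¹ - δ k * ((N : ℝ) + 1 - K)|}
        = {z | ((blockMatrix f z)ᴴ * blockMatrix f z).det ≠ 0} ∩
          {z | t ≤ |(∑ a, ‖R z a‖ ^ 2)⁻¹ - δ k * ((N : ℝ) + 1 - K)|} := by
      ext z
      refine and_congr_right fun hz => ?_
      rw [pinv_eq_gram_inv_mul hz, normSq_eq_sum, hR]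
      rfl
    rw [hset]
    have h1 := measurable_gram_det f
    have h2 : ∀ a, Measurable fun z => R z a := by
      rw [hR]
      exact measurable_gramInv_mul f k
    refine MeasurableSet.inter (h1 (measurableSet_singleton 0).compl) ?_
    exact measurableSet_le measurable_const (by fun_prop)
  set V := otherSpan (blockMatrix f x) k with hV
  set b := stdOrthonormalBasis ℂ Vᗮ with hb
  -- If the complement has the wrong dimension, the frozen columns are dependent, no choice of
  -- column `k` gives full rank, and the event is empty.
  by_cases hn : Module.finrank ℂ Vᗮ + K = N + 1
  swap
  · refine le_trans (le_of_eq (measure_mono_null ?_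
      (measure_empty (μ := Measure.pi fun j => complexGaussian (d j))))) zero_le
    refine fun z hz => hn ?_
    have := (finrank_otherSpan_orthogonal _ k).2 hz.1
    rwa [otherSpan_congr (B := blockMatrix f x)] at this
    intro j hj a
    simp only [blockMatrix, Matrix.of_apply]
    rw [if_neg]
    rintro ⟨b, hb⟩
    exact hj (congrArg Prod.snd (hf hb)).symm
  have hn' : (N : ℝ) + 1 - K = Module.finrank ℂ Vᗮ := by
    rw [sub_eq_iff_eq_add]
    exact_mod_cast hn.symm
  have hmp := measurePreserving_columnMixing hf d hd
    (fun _ : Fin (Module.finrank ℂ Vᗮ) => k)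
    (fun i a => star ((b i : EuclideanSpace ℂ (Fin N)) a)) (by
      intro i i' _
      have := (orthonormal_iff_ite.1 b.orthonormal) i i'
      rw [Submodule.coe_inner, PiLp.inner_apply] at this
      rw [← this]
      refine Finset.sum_congr rfl fun a _ => ?_
      rw [star_star, mul_comm]
      rfl)
  have hbound := measure_abs_sum_sq_complexGaussian_ge_le
    (fun _ : Fin (Module.finrank ℂ Vᗮ) => δ k) (fun _ => hB) hs0 hs t
  rw [Fintype.card_fin, ← hn', ← hmp.measure_preimage
    (measurableSet_le measurable_const (by fun_prop)).nullMeasurableSet] at hbound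
  refine (measure_mono fun z hz => ?_).trans hbound
  obtain ⟨hz1, hz2⟩ := hz
  set z' : J → ℂ := fun j => if ∃ a, f (a, k) = j then z j else x j with hz'
  have hother : ∀ j ≠ k, ∀ a, blockMatrix f z' a j = blockMatrix f x a j := by
    intro j hj a
    simp only [blockMatrix, Matrix.of_apply, hz']
    rw [if_neg]
    rintro ⟨b, hb⟩
    exact hj (congrArg Prod.snd (hf hb)).symm
  have hk : ∀ a, blockMatrix f z' a k = blockMatrix f z a k := by
    intro a
    simp only [blockMatrix, Matrix.of_apply, hz']
    rw [if_pos ⟨a, rfl⟩]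
  rw [inv_normSq_pinv hz1 k, otherSpan_congr hother] at hz2
  simp_rw [hk] at hz2
  change t ≤ |_|
  rw [Finset.sum_sub_distrib, Finset.sum_const, Finset.card_univ, Fintype.card_fin, nsmul_eq_mul,
    ← hn', mul_comm _ ((δ k : NNReal) : ℝ)]
  exact hz2

/-- Concentration of the norm of the product of a row of the pseudo-inverse of a Gaussian matrix
with an independent Gaussian matrix. -/
theorem measure_normSq_pinv_vecMul_le {N K : ℕ} {J : Type*} [Fintype J]
    (f : Fin N × Fin K → J) {g : Fin N × Fin K → J} (hg : Function.Injective g)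
    (hfg : ∀ q r, g q ≠ f r) (d : J → NNReal)
    {δ : Fin K → NNReal} (hd : ∀ a k, d (g (a, k)) = δ k) (k : Fin K) {B : ℝ}
    (hB : ∀ k, δ k ≤ B) {s : ℝ} (hs0 : 0 ≤ s) (hs : s * B ≤ 1 / 2) (t : ℝ) :
    (Measure.pi fun j => complexGaussian (d j))
      {z | ((blockMatrix f z)ᴴ * blockMatrix f z).det ≠ 0 ∧
        t * normSq (pinv (blockMatrix f z) k) ≤
          |normSq (pinv (blockMatrix f z) k ᵥ* blockMatrix g z)
            - normSq (pinv (blockMatrix f z) k) * ∑ k', (δ k' : ℝ)|}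
      ≤ ENNReal.ofReal (2 * Real.exp (-(s * t) + 2 * s ^ 2 * B ^ 2 * K)) := by
  classical
  refine measure_pi_le_of_resample (fun j => ∃ q, g q = j) _ ?_ _ fun x => ?_
  · obtain ⟨R, hR⟩ : ∃ R : (J → ℂ) → Fin N → ℂ, R = fun z a =>
      (((blockMatrix f z)ᴴ * blockMatrix f z)⁻¹ * (blockMatrix f z)ᴴ) k a := ⟨_, rfl⟩
    have hset : {z | ((blockMatrix f z)ᴴ * blockMatrix f z).det ≠ 0 ∧
        t * normSq (pinv (blockMatrix f z) k) ≤
          |normSq (pinv (blockMatrix f z) k ᵥ* blockMatrix g z)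
            - normSq (pinv (blockMatrix f z) k) * ∑ k', (δ k' : ℝ)|}
        = {z | ((blockMatrix f z)ᴴ * blockMatrix f z).det ≠ 0} ∩
          {z | t * (∑ a, ‖R z a‖ ^ 2) ≤ |∑ k', ‖∑ a, R z a * z (g (a, k'))‖ ^ 2
            - (∑ a, ‖R z a‖ ^ 2) * ∑ k', (δ k' : ℝ)|} := by
      ext z
      refine and_congr_right fun hz => ?_
      rw [pinv_eq_gram_inv_mul hz, normSq_eq_sum, normSq_eq_sum, hR]
      rfl
    rw [hset]
    have h1 := measurable_gram_det f
    have h2 : ∀ a, Measurable fun z => R z a := by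
      rw [hR]
      exact measurable_gramInv_mul f k
    refine MeasurableSet.inter (h1 (measurableSet_singleton 0).compl) ?_
    exact measurableSet_le (by fun_prop) (by fun_prop)
  set w := pinv (blockMatrix f x) k with hw
  have hfx : ∀ z : J → ℂ, blockMatrix f (fun j => if ∃ q, g q = j then z j else x j)
      = blockMatrix f x := by
    intro z
    ext a j
    simp only [blockMatrix, Matrix.of_apply]
    rw [if_neg]
    rintro ⟨q, hq⟩
    exact hfg _ _ hq
  have hgz : ∀ z : J → ℂ, blockMatrix g (fun j => if ∃ q, g q = j then z j else x j)
      = blockMatrix g z := by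
    intro z
    ext a j
    simp only [blockMatrix, Matrix.of_apply]
    rw [if_pos ⟨_, rfl⟩]
  simp only [Set.mem_ofPred_eq, hfx, hgz]
  rw [← hw]
  by_cases hdet : ((blockMatrix f x)ᴴ * blockMatrix f x).det = 0
  · simp [hdet]
  have hpos : 0 < normSq w := normSq_pinv_pos hdet k
  -- The row `w` depends only on frozen coordinates, so `w / ν` is a fixed unit vector and its
  -- products with the columns are independent `CN(0, δ j)` variables.
  set ν : ℝ := Real.sqrt (normSq w) with hν
  have hνsq : ν ^ 2 = normSq w := Real.sq_sqrt hpos.le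
  have hmp := measurePreserving_columnMixing hg d hd id (fun _ a => ((ν⁻¹ : ℝ) : ℂ) * w a) (by
      intro i i' hi
      rw [if_pos (show i = i' from hi)]
      have h1 : ∀ a, ((ν⁻¹ : ℝ) : ℂ) * w a * star (((ν⁻¹ : ℝ) : ℂ) * w a)
          = (((ν ^ 2)⁻¹ * ‖w a‖ ^ 2 : ℝ) : ℂ) := by
        intro a
        rw [Complex.star_def, Complex.mul_conj', norm_mul, Complex.norm_real, ← Complex.ofReal_pow,
          mul_pow, Real.norm_eq_abs, sq_abs, inv_pow]
      simp_rw [h1]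
      rw [← Complex.ofReal_sum, ← Finset.mul_sum, ← normSq_eq_sum, hνsq, inv_mul_cancel₀ hpos.ne',
        Complex.ofReal_one])
  have hbound := measure_abs_sum_sq_complexGaussian_ge_le δ hB hs0 hs t
  rw [Fintype.card_fin] at hbound
  have hpre := hmp.measure_preimage (s := {y | t ≤ |∑ j, (‖y j‖ ^ 2 - δ j)|})
    (measurableSet_le measurable_const (by fun_prop)).nullMeasurableSet
  simp only [id] at hpre
  rw [← hpre] at hbound
  refine (measure_mono fun z hz => ?_).trans hbound
  obtain ⟨-, hz2⟩ := hz
  change t ≤ |_|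
  have h3 : ∑ j, (‖∑ a, ((ν⁻¹ : ℝ) : ℂ) * w a * blockMatrix g z a j‖ ^ 2 - (δ j : ℝ))
      = (normSq w)⁻¹ * (normSq (w ᵥ* blockMatrix g z) - normSq w * ∑ k', (δ k' : ℝ)) := by
    rw [Finset.sum_sub_distrib, mul_sub, inv_mul_cancel_left₀ hpos.ne', normSq_eq_sum (_ ᵥ* _),
      Finset.mul_sum]
    congr 1
    refine Finset.sum_congr rfl fun j _ => ?_
    simp_rw [mul_assoc]
    rw [← Finset.mul_sum, norm_mul, mul_pow, Complex.norm_real, Real.norm_eq_abs, sq_abs, inv_pow,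
      hνsq]
    rfl
  rw [h3, abs_mul, abs_of_pos (inv_pos.2 hpos), inv_mul_eq_div, le_div_iff₀ hpos]
  exact hz2

/-! ### Second-order structure of the channel estimates and errors. -/

/-- The covariance of two linear combinations, with coefficients `f` and `g`, of independent
centred variables of variances `v`. -/
def mixCov {ι : Type*} [Fintype ι] (v : ι → NNReal) (f g : ι → ℂ) : ℂ :=
  ∑ x, f x * star (g x) * (v x : ℝ)

section MixCov

variable {ι : Type*} [Fintype ι] (v : ι → NNReal)

theorem mixCov_add_left (f g h : ι → ℂ) : mixCov v (f + g) h = mixCov v f h + mixCov v g h := by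
  simp only [mixCov, ← Finset.sum_add_distrib, Pi.add_apply]
  exact Finset.sum_congr rfl fun x _ => by ring

theorem mixCov_smul_left (c : ℂ) (f g : ι → ℂ) : mixCov v (c • f) g = c * mixCov v f g := by
  simp only [mixCov, Finset.mul_sum, Pi.smul_apply, smul_eq_mul]
  exact Finset.sum_congr rfl fun x _ => by ring

theorem star_mixCov (f g : ι → ℂ) : star (mixCov v f g) = mixCov v g f := by
  simp only [mixCov, star_sum]
  refine Finset.sum_congr rfl fun x _ => ?_
  simp only [star_mul', Complex.star_def, Complex.conj_conj, Complex.conj_ofReal]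
  ring

theorem mixCov_add_right (f g h : ι → ℂ) : mixCov v f (g + h) = mixCov v f g + mixCov v f h := by
  rw [← star_mixCov, mixCov_add_left, star_add, star_mixCov, star_mixCov]

theorem mixCov_smul_right (c : ℂ) (f g : ι → ℂ) :
    mixCov v f (c • g) = star c * mixCov v f g := by
  rw [← star_mixCov, mixCov_smul_left, star_mul', star_mixCov]

theorem mixCov_single_left [DecidableEq ι] (x : ι) (c : ℂ) (g : ι → ℂ) :
    mixCov v (Pi.single x c) g = c * star (g x) * (v x : ℝ) := by
  rw [mixCov, Finset.sum_eq_single x]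
  · simp
  · intro y _ hy
    simp [hy]
  · simp

end MixCov

section Law

variable {L K N τ : ℕ} (β : Fin L → Fin L → ℕ → ℝ) (α p : ℝ) (l : Fin L)
  (Ψ : Matrix (Fin K) (Fin τ) ℂ)

/-- The variances of the entries of a sample. -/
def entryVar : EntryIdx L K N τ → NNReal
  | Sum.inl _ => 1
  | Sum.inr (Sum.inl _) => 1
  | Sum.inr (Sum.inr (i, _, k)) => Real.toNNReal ((1 - α ^ 2) * β l i k)

theorem entryLaw_eq (x : EntryIdx L K N τ) :
    entryLaw β α l x = complexGaussian (entryVar β α l x) := by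
  rcases x with _ | _ | _ <;> rfl

/-- The coefficients of the pilot signal correlated with the pilots. -/
noncomputable def pilotCoef (q : Fin N × Fin K) : EntryIdx L K N τ → ℂ
  | Sum.inl (j, q') => if q' = q then ((Real.sqrt (β l j q.2) : ℝ) : ℂ) else 0
  | Sum.inr (Sum.inl (a, t)) =>
      if a = q.1 then (((Real.sqrt (pTr p τ))⁻¹ : ℝ) : ℂ) * star (Ψ q.2 t) else 0
  | Sum.inr (Sum.inr _) => 0

/-- The coefficients of the channel at the previous symbol. -/
noncomputable def channelCoef (i : Fin L) (q : Fin N × Fin K) : EntryIdx L K N τ → ℂ :=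
  Pi.single (Sum.inl (i, q)) ((Real.sqrt (β l i q.2) : ℝ) : ℂ)

/-- The coefficients of the innovation. -/
def innovCoef (i : Fin L) (q : Fin N × Fin K) : EntryIdx L K N τ → ℂ :=
  Pi.single (Sum.inr (Sum.inr (i, q))) 1

/-- The variance of the pilot signal correlated with the pilots. -/
noncomputable def pilotVar (τ : ℕ) (k : ℕ) : ℝ := (∑ j, β l j k) + 1 / pTr p τ

variable {β α p l Ψ}

/-- Orthonormal pilots separate the users within a cell and keep the despread noise white, of
variance `1 / p_tr`. The channels of user `k` of all cells add up. -/
theorem mixCov_pilotCoef (hβ : ∀ i k, 0 < β l i k) (hp : 0 < pTr p τ) (hΨ : Ψ * Ψᴴ = 1)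
    (q r : Fin N × Fin K) :
    mixCov (entryVar β α l) (pilotCoef β p l Ψ q) (pilotCoef β p l Ψ r)
      = if q = r then ((pilotVar β p l τ q.2 : ℝ) : ℂ) else 0 := by
  rw [mixCov, Fintype.sum_sum_type, Fintype.sum_sum_type, Fintype.sum_prod_type,
    Fintype.sum_prod_type (f := fun x => pilotCoef β p l Ψ q (Sum.inr (Sum.inl x)) * _ * _)]
  have h1 : ∀ j, ∑ y : Fin N × Fin K, pilotCoef β p l Ψ q (Sum.inl (j, y))
      * star (pilotCoef (τ := τ) β p l Ψ r (Sum.inl (j, y)))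
      * ((entryVar (τ := τ) β α l (Sum.inl (j, y)) : NNReal) : ℝ)
      = if q = r then ((β l j q.2 : ℝ) : ℂ) else 0 := by
    intro j
    rw [Finset.sum_eq_single q]
    · by_cases h : q = r
      · subst h
        simp only [pilotCoef, entryVar, if_true, Complex.star_def, Complex.conj_ofReal,
          ← Complex.ofReal_mul, Real.mul_self_sqrt (hβ j q.2).le]
        simp
      · simp [pilotCoef, h]
    · intro y _ hy
      simp [pilotCoef, hy]
    · simp
  have h2 : ∑ a : Fin N, ∑ t : Fin τ, pilotCoef β p l Ψ q (Sum.inr (Sum.inl (a, t)))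
      * star (pilotCoef β p l Ψ r (Sum.inr (Sum.inl (a, t))))
      * ((entryVar (K := K) β α l (Sum.inr (Sum.inl (a, t))) : NNReal) : ℝ)
      = if q = r then ((1 / pTr p τ : ℝ) : ℂ) else 0 := by
    rw [Finset.sum_eq_single q.1]
    · by_cases h : q.1 = r.1
      · have h3 : ∑ t, star (Ψ q.2 t) * Ψ r.2 t = if q.2 = r.2 then 1 else 0 := by
          have := congrFun (congrFun hΨ r.2) q.2
          rw [Matrix.mul_apply, Matrix.one_apply] at this
          simp only [eq_comm (a := q.2)]
          rw [← this]
          exact Finset.sum_congr rfl fun t _ => by rw [conjTranspose_apply, mul_comm]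
        simp only [pilotCoef, entryVar, if_pos h, if_true]
        have h4 : ∀ t, (((Real.sqrt (pTr p τ))⁻¹ : ℝ) : ℂ) * star (Ψ q.2 t)
            * star ((((Real.sqrt (pTr p τ))⁻¹ : ℝ) : ℂ) * star (Ψ r.2 t)) * ((1 : NNReal) : ℝ)
            = ((1 / pTr p τ : ℝ) : ℂ) * (star (Ψ q.2 t) * Ψ r.2 t) := by
          intro t
          have h5 : (Real.sqrt (pTr p τ))⁻¹ * (Real.sqrt (pTr p τ))⁻¹ = 1 / pTr p τ := by
            rw [← mul_inv, Real.mul_self_sqrt hp.le, one_div]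
          rw [← h5]
          simp only [star_mul', Complex.star_def, Complex.conj_conj, Complex.conj_ofReal]
          push_cast
          ring
        simp_rw [h4]
        rw [← Finset.mul_sum, h3]
        by_cases h6 : q.2 = r.2
        · rw [if_pos h6, if_pos (Prod.ext h h6), mul_one]
        · rw [if_neg h6, if_neg (fun h => h6 (congrArg Prod.snd h)), mul_zero]
      · rw [if_neg (fun h' => h (congrArg Prod.fst h'))]
        simp [pilotCoef, h]
    · intro a _ ha
      simp [pilotCoef, ha]
    · simp
  simp_rw [h1]
  rw [h2]
  by_cases h : q = r
  · simp [h, pilotCoef, pilotVar]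
  · simp [h, pilotCoef]

theorem mixCov_channelCoef_pilotCoef (hβ : ∀ i k, 0 < β l i k) (i : Fin L)
    (q r : Fin N × Fin K) :
    mixCov (entryVar β α l) (channelCoef β l i q) (pilotCoef β p l Ψ r)
      = if q = r then ((β l i q.2 : ℝ) : ℂ) else 0 := by
  rw [channelCoef, mixCov_single_left]
  by_cases h : q = r
  · subst h
    simp only [pilotCoef, entryVar, if_true, Complex.star_def, Complex.conj_ofReal,
      ← Complex.ofReal_mul, Real.mul_self_sqrt (hβ i q.2).le]
    simp
  · simp [pilotCoef, h]

theorem mixCov_channelCoef (hβ : ∀ i k, 0 < β l i k) (i : Fin L) (q r : Fin N × Fin K) :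
    mixCov (entryVar (τ := τ) β α l) (channelCoef β l i q) (channelCoef β l i r)
      = if q = r then ((β l i q.2 : ℝ) : ℂ) else 0 := by
  rw [channelCoef, mixCov_single_left, channelCoef]
  by_cases h : q = r
  · subst h
    simp only [Pi.single_eq_same, entryVar, if_true, Complex.star_def, Complex.conj_ofReal,
      ← Complex.ofReal_mul, Real.mul_self_sqrt (hβ i q.2).le]
    simp
  · simp [h]

theorem mixCov_innovCoef (hβ : ∀ i k, 0 < β l i k) (hα : |α| ≤ 1) (i : Fin L)
    (q r : Fin N × Fin K) :
    mixCov (entryVar (τ := τ) β α l) (innovCoef i q) (innovCoef i r)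
      = if q = r then (((1 - α ^ 2) * β l i q.2 : ℝ) : ℂ) else 0 := by
  have h0 : 0 ≤ (1 - α ^ 2) * β l i q.2 :=
    mul_nonneg (by have := (sq_le_one_iff_abs_le_one α).2 hα; linarith) (hβ i q.2).le
  rw [innovCoef, mixCov_single_left, innovCoef]
  by_cases h : q = r
  · subst h
    simp [entryVar, Real.coe_toNNReal _ h0]
  · simp [h]

theorem mixCov_innovCoef_pilotCoef (i : Fin L) (q r : Fin N × Fin K) :
    mixCov (entryVar β α l) (innovCoef i q) (pilotCoef β p l Ψ r) = 0 := by
  rw [innovCoef, mixCov_single_left]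
  simp [pilotCoef]

theorem mixCov_innovCoef_channelCoef (i : Fin L) (q r : Fin N × Fin K) :
    mixCov (entryVar (τ := τ) β α l) (innovCoef i q) (channelCoef β l i r) = 0 := by
  rw [innovCoef, mixCov_single_left]
  simp [channelCoef]

variable (β α p l Ψ)

/-- The coefficients of the channel estimate of the own cell and of the error matrix of cell
`i`. -/
noncomputable def jointCoef (i : Fin L) : (Fin N × Fin K) ⊕ (Fin N × Fin K) → EntryIdx L K N τ → ℂ
  | Sum.inl q => ((β l l q.2 * (pilotVar β p l τ q.2)⁻¹ : ℝ) : ℂ) • pilotCoef β p l Ψ q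
  | Sum.inr q => (α : ℂ) • channelCoef β l i q + innovCoef i q
      + ((-(α * β l i q.2 * (pilotVar β p l τ q.2)⁻¹) : ℝ) : ℂ) • pilotCoef β p l Ψ q

/-- The variances of the entries of the channel estimate of the own cell and of the error matrix
of cell `i`. -/
noncomputable def jointVar (τ : ℕ) (i : Fin L) : (Fin N × Fin K) ⊕ (Fin N × Fin K) → NNReal
  | Sum.inl q => Real.toNNReal (betaHat β p τ l l q.2)
  | Sum.inr q => Real.toNNReal (β l i q.2 - α ^ 2 * betaHat β p τ l i q.2)

/-- The entries of the channel estimate of the own cell and of the error matrix of cell `i`. -/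
noncomputable def jointVec (i : Fin L) (s : Sample L K N τ) : (Fin N × Fin K) ⊕ (Fin N × Fin K) → ℂ
  | Sum.inl q => s.estimate β p l Ψ l q.1 q.2
  | Sum.inr q => s.errorMatrix β α p l Ψ i q.1 q.2

theorem betaHat_eq (τ : ℕ) (i : Fin L) (k : ℕ) :
    betaHat β p τ l i k = β l i k ^ 2 / pilotVar β p l τ k := rfl

variable {β α p l Ψ}

theorem pilotVar_pos (hβ : ∀ i k, 0 < β l i k) (hp : 0 < pTr p τ) (k : ℕ) :
    0 < pilotVar β p l τ k :=
  add_pos_of_nonneg_of_pos (Finset.sum_nonneg fun j _ => (hβ j k).le) (by positivity)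

theorem betaHat_pos (hβ : ∀ i k, 0 < β l i k) (hp : 0 < pTr p τ) (i : Fin L) (k : ℕ) :
    0 < betaHat β p τ l i k :=
  div_pos (pow_pos (hβ i k) 2) (pilotVar_pos hβ hp k)

theorem betaHat_le (hβ : ∀ i k, 0 < β l i k) (hp : 0 < pTr p τ) (i : Fin L) (k : ℕ) :
    betaHat β p τ l i k ≤ β l i k := by
  rw [betaHat_eq, div_le_iff₀ (pilotVar_pos hβ hp k), sq, pilotVar]
  refine mul_le_mul_of_nonneg_left ?_ (hβ i k).le
  have h1 := Finset.single_le_sum (f := fun j => β l j k) (fun j _ => (hβ j k).le)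
    (Finset.mem_univ i)
  have h2 : 0 < 1 / pTr p τ := by positivity
  linarith

theorem errorVar_nonneg (hβ : ∀ i k, 0 < β l i k) (hα : |α| ≤ 1) (hp : 0 < pTr p τ) (i : Fin L)
    (k : ℕ) : 0 ≤ β l i k - α ^ 2 * betaHat β p τ l i k := by
  have h1 := betaHat_le hβ hp i k
  have h2 := (betaHat_pos hβ hp i k).le
  have h3 := (sq_le_one_iff_abs_le_one α).2 hα
  nlinarith

/-- The orthogonality principle: `β_{lik} / pilotVar` is the regression coefficient of the channel
on the pilot observation. The error is thus uncorrelated with that observation, and with `Ĝ_{ll}`, a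
multiple of it. Its variance is `α² (β - β̂) + (1 - α²) β = β - α² β̂`. -/
theorem mixCov_jointCoef (hβ : ∀ i k, 0 < β l i k) (hα : |α| ≤ 1) (hp : 0 < pTr p τ)
    (hΨ : Ψ * Ψᴴ = 1) (i : Fin L) (x y : (Fin N × Fin K) ⊕ (Fin N × Fin K)) :
    mixCov (entryVar β α l) (jointCoef β α p l Ψ i x) (jointCoef β α p l Ψ i y)
      = if x = y then (((jointVar β α p l τ i x : NNReal) : ℝ) : ℂ) else 0 := by
  have pc : ∀ q r : Fin N × Fin K,
      mixCov (entryVar β α l) (pilotCoef β p l Ψ q) (channelCoef β l i r)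
        = if q = r then ((β l i q.2 : ℝ) : ℂ) else 0 := by
    intro q r
    rw [← star_mixCov, mixCov_channelCoef_pilotCoef hβ]
    by_cases h : q = r
    · simp [h]
    · simp [h, Ne.symm h]
  have pi' : ∀ q r : Fin N × Fin K,
      mixCov (entryVar β α l) (pilotCoef β p l Ψ q) (innovCoef i r) = 0 := by
    intro q r
    rw [← star_mixCov, mixCov_innovCoef_pilotCoef, star_zero]
  have ci : ∀ q r : Fin N × Fin K,
      mixCov (entryVar (τ := τ) β α l) (channelCoef β l i q) (innovCoef i r) = 0 := by
    intro q r
    rw [← star_mixCov, mixCov_innovCoef_channelCoef, star_zero]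
  rcases x with q | q <;> rcases y with r | r
  all_goals
    simp only [jointCoef, mixCov_add_left, mixCov_add_right, mixCov_smul_left, mixCov_smul_right,
      mixCov_pilotCoef hβ hp hΨ, mixCov_channelCoef_pilotCoef hβ, mixCov_channelCoef hβ,
      mixCov_innovCoef hβ hα, mixCov_innovCoef_pilotCoef, mixCov_innovCoef_channelCoef, pc, pi', ci,
      Complex.star_def, Complex.conj_ofReal, Sum.inl.injEq, Sum.inr.injEq, reduceCtorEq, if_false]
    by_cases h : q = r
    swap
    · simp [h]
    subst h
    have hc := pilotVar_pos hβ hp q.2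
    simp only [if_true, jointVar, Real.coe_toNNReal _ (betaHat_pos hβ hp l q.2).le,
      Real.coe_toNNReal _ (errorVar_nonneg hβ hα hp i q.2)]
    norm_cast
    try simp only [betaHat_eq]
    field_simp
    try ring

theorem sum_pilotCoef_mul_entry (hp : 0 < pTr p τ) (hΨ : Ψ * Ψᴴ = 1) (s : Sample L K N τ)
    (q : Fin N × Fin K) :
    ∑ x, pilotCoef β p l Ψ q x * s.entry x
      = (((Real.sqrt (pTr p τ))⁻¹ : ℝ) : ℂ) * (s.receivedPilots β p l Ψ * Ψᴴ) q.1 q.2 := by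
  have hs : Real.sqrt (pTr p τ) ≠ 0 := (Real.sqrt_pos.2 hp).ne'
  have h1 : s.receivedPilots β p l Ψ * Ψᴴ
      = ((Real.sqrt (pTr p τ) : ℝ) : ℂ) • (∑ i, s.prevChannel β l i) + s.noise * Ψᴴ := by
    rw [Sample.receivedPilots, Matrix.add_mul, Matrix.smul_mul, Matrix.sum_mul]
    simp_rw [Matrix.mul_assoc, hΨ, Matrix.mul_one]
  rw [h1, Matrix.add_apply, Matrix.smul_apply, Matrix.sum_apply, mul_add, smul_eq_mul, ← mul_assoc,
    ← Complex.ofReal_mul, inv_mul_cancel₀ hs, Complex.ofReal_one, one_mul, Fintype.sum_sum_type,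
    Fintype.sum_sum_type, Fintype.sum_prod_type,
    Fintype.sum_prod_type (f := fun x => pilotCoef β p l Ψ q (Sum.inr (Sum.inl x)) * _)]
  congr 1
  · refine Finset.sum_congr rfl fun j _ => ?_
    rw [Finset.sum_eq_single q]
    · simp [pilotCoef, Sample.entry, Sample.prevChannel]
    · intro y _ hy
      simp [pilotCoef, hy]
    · simp
  · rw [Finset.sum_eq_single q.1]
    · rw [Matrix.mul_apply, Finset.mul_sum]
      simp only [pilotCoef, Sample.entry, if_true, zero_mul, Finset.sum_const_zero, add_zero]
      refine Finset.sum_congr rfl fun t _ => ?_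
      rw [conjTranspose_apply]
      ring
    · intro a _ ha
      simp [pilotCoef, ha]
    · simp

theorem estimate_apply (hp : 0 < pTr p τ) (hΨ : Ψ * Ψᴴ = 1) (s : Sample L K N τ) (i : Fin L)
    (q : Fin N × Fin K) :
    s.estimate β p l Ψ i q.1 q.2 = ((β l i q.2 * (pilotVar β p l τ q.2)⁻¹ : ℝ) : ℂ)
      * ∑ x, pilotCoef β p l Ψ q x * s.entry x := by
  rw [sum_pilotCoef_mul_entry hp hΨ, Sample.estimate, Matrix.of_apply, ← mul_assoc,
    ← Complex.ofReal_mul, pilotVar, add_comm (1 / pTr p τ)]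

theorem sum_jointCoef_mul_entry (hp : 0 < pTr p τ) (hΨ : Ψ * Ψᴴ = 1) (s : Sample L K N τ)
    (i : Fin L) (x : (Fin N × Fin K) ⊕ (Fin N × Fin K)) :
    ∑ y, jointCoef β α p l Ψ i x y * s.entry y = jointVec β α p l Ψ i s x := by
  rcases x with q | q
  · simp only [jointCoef, jointVec, Pi.smul_apply, smul_eq_mul, estimate_apply hp hΨ,
      Finset.mul_sum, mul_assoc]
  · simp only [jointCoef, jointVec, Pi.add_apply, Pi.smul_apply, smul_eq_mul, add_mul,
      Finset.sum_add_distrib, Sample.errorMatrix, Matrix.sub_apply, Matrix.smul_apply,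
      estimate_apply hp hΨ, Sample.currChannel, Matrix.add_apply]
    rw [sub_eq_add_neg]
    congr 1
    · congr 1
      · rw [Finset.sum_eq_single (Sum.inl (i, q))]
        · simp [channelCoef, Sample.prevChannel, Sample.entry, mul_assoc]
        · intro y _ hy
          simp [channelCoef, hy]
        · simp
      · rw [Finset.sum_eq_single (Sum.inr (Sum.inr (i, q)))]
        · simp [innovCoef, Sample.entry]
        · intro y _ hy
          simp [innovCoef, hy]
        · simp
    · rw [← mul_assoc, Finset.mul_sum, ← Finset.sum_neg_distrib]
      refine Finset.sum_congr rfl fun y _ => ?_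
      push_cast
      ring

/-- The entries of the channel estimate of the own cell and of an error matrix are independent
complex Gaussians. -/
theorem hasLaw_jointVec {Ω : Type*} [MeasurableSpace Ω] {P : Measure Ω}
    {S : Ω → Sample L K N τ} (hS : IsModel P β α l S) (hβ : ∀ i k, 0 < β l i k) (hα : |α| ≤ 1)
    (hp : 0 < pTr p τ) (hΨ : Ψ * Ψᴴ = 1) (i : Fin L) :
    HasLaw (fun ω => jointVec β α p l Ψ i (S ω))
      (Measure.pi fun x => complexGaussian (jointVar β α p l τ i x)) P := by
  have h1 : HasLaw (fun ω x => (S ω).entry x)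
      (Measure.pi fun x => complexGaussian (entryVar β α l x)) P := by
    have := hS.indep.hasLaw_pi hS.law
    rw [show entryLaw β α l = fun x => complexGaussian (entryVar β α l x) from
      funext (entryLaw_eq β α l)] at this
    exact this
  have h2 := measurePreserving_mixing (entryVar (N := N) β α l) (jointVar β α p l τ i)
    (jointCoef β α p l Ψ i) (mixCov_jointCoef hβ hα hp hΨ i)
  have h3 := h2.fun_comp_hasLaw h1
  simp only [sum_jointCoef_mul_entry hp hΨ] at h3
  exact h3

end Law

/-! ### The SINR and its concentration bounds in one system. -/

section Stage

variable {L K N τ : ℕ} {β : Fin L → Fin L → ℕ → ℝ} {α p : ℝ} {l : Fin L}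
  {Ψ : Matrix (Fin K) (Fin τ) ℂ}

/-- Pilot contamination: the estimates for all cells are multiples of one and the same observation.
-/
theorem estimate_eq_ratio_mul (hβ : ∀ i k, 0 < β l i k) (s : Sample L K N τ) (i : Fin L)
    (a : Fin N) (k : Fin K) :
    s.estimate β p l Ψ i a k = ((β l i k / β l l k : ℝ) : ℂ) * s.estimate β p l Ψ l a k := by
  simp only [Sample.estimate, Matrix.of_apply, ← mul_assoc]
  congr 1
  rw [← Complex.ofReal_mul]
  congr 1
  have := (hβ l k).ne'
  field_simp

/-- With an estimate of full column rank the interference caused by pilot contamination is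
deterministic. -/
theorem normSq_zfRow_vecMul_estimate (hβ : ∀ i k, 0 < β l i k) {s : Sample L K N τ}
    (h : ((s.estimate β p l Ψ l)ᴴ * s.estimate β p l Ψ l).det ≠ 0) (i : Fin L) (k : Fin K) :
    normSq (s.zfRow β p l Ψ k ᵥ* s.estimate β p l Ψ i) = (β l i k / β l l k) ^ 2 := by
  have h1 : ∀ k', (s.zfRow β p l Ψ k ᵥ* s.estimate β p l Ψ i) k'
      = ((β l i k' / β l l k' : ℝ) : ℂ) * if k = k' then 1 else 0 := by
    intro k'
    rw [← Matrix.one_apply, ← pinv_mul_self h, Matrix.mul_apply, Finset.mul_sum]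
    change ∑ a, s.zfRow β p l Ψ k a * s.estimate β p l Ψ i a k' = _
    refine Finset.sum_congr rfl fun a _ => ?_
    rw [estimate_eq_ratio_mul hβ]
    simp only [Sample.zfRow]
    ring
  rw [normSq_eq_sum, Finset.sum_eq_single k]
  · rw [h1, if_pos rfl, mul_one, Complex.norm_real, Real.norm_eq_abs, sq_abs]
  · intro k' _ hk'
    rw [h1, if_neg hk'.symm]
    simp
  · simp

theorem sinr_eq (hβ : ∀ i k, 0 < β l i k) {s : Sample L K N τ}
    (h : ((s.estimate β p l Ψ l)ᴴ * s.estimate β p l Ψ l).det ≠ 0) (k : Fin K) :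
    s.sinr β α p l Ψ k = α ^ 2 * p / (α ^ 2 * p * contamination β l k
      + p * (∑ i, normSq (s.zfRow β p l Ψ k ᵥ* s.errorMatrix β α p l Ψ i))
      + normSq (s.zfRow β p l Ψ k)) := by
  simp_rw [Sample.sinr, normSq_zfRow_vecMul_estimate hβ h, contamination]

variable {Ω : Type*} [MeasurableSpace Ω] {P : Measure Ω} {S : Ω → Sample L K N τ}

theorem ae_estimate_gram_det_ne_zero (hS : IsModel P β α l S) (hβ : ∀ i k, 0 < β l i k)
    (hα : |α| ≤ 1) (hp : 0 < pTr p τ) (hΨ : Ψ * Ψᴴ = 1) (hKN : K ≤ N) :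
    ∀ᵐ ω ∂P, (((S ω).estimate β p l Ψ l)ᴴ * (S ω).estimate β p l Ψ l).det ≠ 0 := by
  have h1 := hasLaw_jointVec hS hβ hα hp hΨ l
  have h2 := ae_gram_det_ne_zero hKN Sum.inl_injective (jointVar (N := N) (K := K) β α p l τ l)
    (δ := fun k => Real.toNNReal (betaHat β p τ l l k)) (fun _ _ => rfl)
    (fun k => (Real.toNNReal_pos.2 (betaHat_pos hβ hp l k)).ne')
  rw [← h1.map_eq] at h2
  exact ae_of_ae_map h1.aemeasurable h2

theorem measure_inv_normSq_zfRow_le (hS : IsModel P β α l S) (hβ : ∀ i k, 0 < β l i k)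
    (hα : |α| ≤ 1) (hp : 0 < pTr p τ) (hΨ : Ψ * Ψᴴ = 1) (k : Fin K) {B : ℝ}
    (hB : β l l k ≤ B) {s : ℝ} (hs0 : 0 ≤ s) (hs : s * B ≤ 1 / 2) (t : ℝ) :
    P {ω | (((S ω).estimate β p l Ψ l)ᴴ * (S ω).estimate β p l Ψ l).det ≠ 0 ∧
        t ≤ |(normSq ((S ω).zfRow β p l Ψ k))⁻¹ - betaHat β p τ l l k * ((N : ℝ) + 1 - K)|}
      ≤ ENNReal.ofReal (2 * Real.exp (-(s * t) + 2 * s ^ 2 * B ^ 2 * ((N : ℝ) + 1 - K))) := by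
  have h1 := hasLaw_jointVec hS hβ hα hp hΨ l
  have hb := (betaHat_pos hβ hp l k).le
  have h2 := measure_inv_normSq_pinv_le Sum.inl_injective
    (jointVar (N := N) (K := K) β α p l τ l)
    (δ := fun k => Real.toNNReal (betaHat β p τ l l k)) (fun _ _ => rfl) k (B := B)
    (by rw [Real.coe_toNNReal _ hb]; exact (betaHat_le hβ hp l k).trans hB) hs0 hs t
  rw [Real.coe_toNNReal _ hb, ← h1.map_eq] at h2
  -- This inequality holds for arbitrary sets, so the event itself needs no measurability.
  exact (Measure.le_map_apply h1.aemeasurable _).trans h2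

theorem measure_normSq_zfRow_vecMul_le (hS : IsModel P β α l S) (hβ : ∀ i k, 0 < β l i k)
    (hα : |α| ≤ 1) (hp : 0 < pTr p τ) (hΨ : Ψ * Ψᴴ = 1) (i : Fin L) (k : Fin K) {B : ℝ}
    (hB : ∀ k : Fin K, β l i k - α ^ 2 * betaHat β p τ l i k ≤ B) {s : ℝ} (hs0 : 0 ≤ s)
    (hs : s * B ≤ 1 / 2) (t : ℝ) :
    P {ω | (((S ω).estimate β p l Ψ l)ᴴ * (S ω).estimate β p l Ψ l).det ≠ 0 ∧
        t * normSq ((S ω).zfRow β p l Ψ k) ≤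
          |normSq ((S ω).zfRow β p l Ψ k ᵥ* (S ω).errorMatrix β α p l Ψ i)
            - normSq ((S ω).zfRow β p l Ψ k) * (errorCov β α p τ l i K).trace|}
      ≤ ENNReal.ofReal (2 * Real.exp (-(s * t) + 2 * s ^ 2 * B ^ 2 * K)) := by
  have h1 := hasLaw_jointVec hS hβ hα hp hΨ i
  have hd := fun k : Fin K => Real.coe_toNNReal _ (errorVar_nonneg hβ hα hp i k)
  have h2 := measure_normSq_pinv_vecMul_le Sum.inl Sum.inr_injective
    (fun _ _ => Sum.inr_ne_inl) (jointVar (N := N) (K := K) β α p l τ i)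
    (δ := fun k => Real.toNNReal (β l i k - α ^ 2 * betaHat β p τ l i k)) (fun _ _ => rfl) k
    (B := B) (fun k => by rw [hd]; exact hB k) hs0 hs t
  simp_rw [hd] at h2
  rw [← h1.map_eq] at h2
  have h3 : (errorCov β α p τ l i K).trace
      = ∑ k : Fin K, (β l i k - α ^ 2 * betaHat β p τ l i k) := Matrix.trace_diagonal _
  rw [h3]
  exact (Measure.le_map_apply h1.aemeasurable _).trans h2

/-- Turns the spectral norm assumption into the uniform bound on variances that the Chernoff
estimate needs. -/
theorem errorVar_le_specNorm (i : Fin L) (k : Fin K) :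
    β l i k - α ^ 2 * betaHat β p τ l i k ≤ specNorm (errorCov β α p τ l i K) := by
  set T := Matrix.toEuclideanCLM (n := Fin K) (𝕜 := ℝ) (errorCov β α p τ l i K) with hT
  have h1 := T.le_opNorm (EuclideanSpace.single k 1)
  have h2 := PiLp.norm_apply_le (T (EuclideanSpace.single k 1)) k
  have h3 : T (EuclideanSpace.single k 1) k = β l i k - α ^ 2 * betaHat β p τ l i k := by
    rw [hT, errorCov]
    simp [Matrix.mulVec_diagonal]
  rw [h3] at h2
  rw [PiLp.norm_single, norm_one, mul_one] at h1
  exact (le_abs_self _).trans (h2.trans h1)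

end Stage

/-! ### From exponential tails to almost sure convergence; stability of the quotient. -/

/-- The first entry of the minimum makes `s` admissible for Chernoff. The second makes the quadratic
term cost at most half of the linear gain, leaving the rate `c = s ε / 2`. -/
theorem exists_exponential_rate {B M ε : ℝ} (hB : 0 < B) (hM : 0 < M) (hε : 0 < ε) :
    ∃ s : ℝ, 0 ≤ s ∧ s * B ≤ 1 / 2 ∧ ∃ c : ℝ, 0 < c ∧ ∀ K n : ℝ, n ≤ M * K →
      0 ≤ K → -(s * (ε * K)) + 2 * s ^ 2 * B ^ 2 * n ≤ -(c * K) := by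
  set s := min (1 / (2 * B)) (ε / (4 * B ^ 2 * M)) with hs
  have hs0 : 0 < s := lt_min (by positivity) (by positivity)
  have h1 : s * B ≤ 1 / 2 := by
    calc s * B ≤ 1 / (2 * B) * B := by gcongr; exact min_le_left _ _
      _ = 1 / 2 := by field_simp
  have h2 : s * (4 * B ^ 2 * M) ≤ ε := by
    rw [← le_div_iff₀ (by positivity)]
    exact min_le_right _ _
  refine ⟨s, hs0.le, h1, s * ε / 2, by positivity, fun K n hn hK => ?_⟩
  have h3 : 2 * s ^ 2 * B ^ 2 * n ≤ 2 * s ^ 2 * B ^ 2 * (M * K) := by gcongr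
  have h4 : s * (4 * B ^ 2 * M) * (s * K / 2) ≤ ε * (s * K / 2) := by gcongr
  nlinarith

theorem ae_eventually_not_of_exponential {Ω : Type*} [MeasurableSpace Ω] {P : Measure Ω}
    {A : ℕ → Set Ω} {c : ℝ} (hc : 0 < c)
    (h : ∀ m, P (A m) ≤ ENNReal.ofReal (2 * Real.exp (-(c * m)))) :
    ∀ᵐ ω ∂P, ∀ᶠ m in atTop, ω ∉ A m := by
  refine ae_eventually_notMem (ne_top_of_le_ne_top ?_ (ENNReal.tsum_le_tsum h))
  have : Summable fun m : ℕ => 2 * Real.exp (-(c * m)) := by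
    refine Summable.mul_left 2 ?_
    refine (Real.summable_exp_nat_mul_iff.2 (neg_neg_of_pos hc)).congr fun m => ?_
    rw [mul_neg, mul_comm]
  exact this.tsum_ofReal_ne_top

/-- Countably many tolerances suffice, which lets a single null set serve them all. -/
theorem tendsto_zero_of_eventually_abs_lt {u : ℕ → ℝ}
    (h : ∀ n : ℕ, ∀ᶠ m in atTop, |u m| < 1 / ((n : ℝ) + 1)) : Tendsto u atTop (𝓝 0) := by
  rw [Metric.tendsto_nhds]
  intro ε hε
  obtain ⟨n, hn⟩ := exists_nat_one_div_lt hε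
  filter_upwards [h n] with m hm
  rw [Real.dist_0_eq_abs]
  exact hm.trans hn

/-- Stability of the quotient `a u / (a C u + x)`. -/
theorem tendsto_quotient_sub_quotient {a C c V T₀ : ℝ} {u v x T : ℕ → ℝ} (hc : 0 < c)
    (hv : ∀ m, |v m| ≤ V) (hT : ∀ m, |T m| ≤ T₀)
    (hD : ∀ᶠ m in atTop, c ≤ a * C * v m + T m)
    (huv : Tendsto (fun m => u m - v m) atTop (𝓝 0))
    (hxT : Tendsto (fun m => x m - T m) atTop (𝓝 0)) :
    Tendsto (fun m => a * u m / (a * C * u m + x m) - a * v m / (a * C * v m + T m))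
      atTop (𝓝 0) := by
  have h1 : Tendsto (fun m => (a * C * u m + x m) - (a * C * v m + T m)) atTop (𝓝 0) := by
    have := (huv.const_mul (a * C)).add hxT
    rw [mul_zero, add_zero] at this
    refine this.congr fun m => by ring
  have h2 : Tendsto (fun m => |a| * (|u m - v m| * T₀ + V * |x m - T m|) / (c / 2 * c))
      atTop (𝓝 0) := by
    have := (((huv.abs.mul_const T₀).add (hxT.abs.const_mul V)).const_mul |a|).div_const
      (c / 2 * c)
    simpa using this
  refine squeeze_zero_norm' ?_ h2
  filter_upwards [hD, h1.eventually (lt_mem_nhds (show -(c / 2) < 0 by linarith))] with m hm hm'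
  have hD2 : 0 < a * C * v m + T m := hc.trans_le hm
  have hD1' : c / 2 ≤ a * C * u m + x m := by linarith
  have hD1 : 0 < a * C * u m + x m := by linarith
  -- The terms `a C u v` cancel in the cross product, leaving `u T - v x = (u - v) T - v (x - T)`.
  -- Only `v` and `T` then need to be bounded.
  have h3 : a * u m / (a * C * u m + x m) - a * v m / (a * C * v m + T m)
      = a * ((u m - v m) * T m - v m * (x m - T m))
        / ((a * C * u m + x m) * (a * C * v m + T m)) := by
    rw [div_sub_div _ _ hD1.ne' hD2.ne']
    congr 1
    ring
  rw [h3, Real.norm_eq_abs, abs_div, abs_mul, abs_of_pos (mul_pos hD1 hD2)]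
  have h4 : |(u m - v m) * T m - v m * (x m - T m)|
      ≤ |u m - v m| * T₀ + V * |x m - T m| := by
    refine (abs_sub _ _).trans ?_
    rw [abs_mul, abs_mul]
    gcongr
    · exact hT m
    · exact hv m
  have hV : 0 ≤ |u m - v m| * T₀ + V * |x m - T m| := (abs_nonneg _).trans h4
  gcongr

theorem contamination_nonneg {L : ℕ} (β : Fin L → Fin L → ℕ → ℝ) (l : Fin L) (k : ℕ) :
    0 ≤ contamination β l k := Finset.sum_nonneg fun _ _ => sq_nonneg _

theorem contamination_pos {L : ℕ} {β : Fin L → Fin L → ℕ → ℝ} {l : Fin L}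
    (hβ : ∀ i k, 0 < β l i k) (hL : 2 ≤ L) (k : ℕ) : 0 < contamination β l k := by
  refine Finset.sum_pos (fun i _ => pow_pos (div_pos (hβ i k) (hβ l k)) 2) ?_
  rw [← Finset.card_pos, Finset.card_erase_of_mem (Finset.mem_univ l), Finset.card_univ,
    Fintype.card_fin]
  omega

/-- More training power improves the estimate, so `τ = 1` gives a positive lower bound valid along
the whole sequence. -/
theorem le_betaHat {L : ℕ} {β : Fin L → Fin L → ℕ → ℝ} {l : Fin L} (hβ : ∀ i k, 0 < β l i k)
    {p : ℝ} (hp : 0 < p) {τ : ℕ} (hτ : 1 ≤ τ) (i : Fin L) (k : ℕ) :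
    betaHat β p 1 l i k ≤ betaHat β p τ l i k := by
  have h1 : (1 : ℝ) ≤ τ := by exact_mod_cast hτ
  have h2 : 0 < pTr p τ := mul_pos (by linarith) hp
  have h3 : pTr p 1 ≤ pTr p τ := by
    simp only [pTr, Nat.cast_one]
    gcongr
  have h4 : 0 < pTr p 1 := by simpa [pTr] using hp
  have h5 : pilotVar β p l τ k ≤ pilotVar β p l 1 k := by
    unfold pilotVar
    gcongr
  rw [betaHat_eq, betaHat_eq]
  have := pilotVar_pos hβ h2 k
  gcongr

/-! ### Almost sure limits along the sequence of systems. -/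

section Sequence

variable {L : ℕ} {l : Fin L} {β : Fin L → Fin L → ℕ → ℝ} {α p κ : ℝ} {K N τ : ℕ → ℕ}
  {Ψ : ∀ m, Matrix (Fin (K m)) (Fin (τ m)) ℂ} {k : ℕ} {Ω : Type*} [MeasurableSpace Ω]
  {P : Measure Ω} {S : ∀ m, Ω → Sample L (K m) (N m) (τ m)}

/-- The normalised inverse norm of the zero-forcing row approaches its deterministic
equivalent. -/
theorem ae_tendsto_inv_normSq_zfRow (hβ : ∀ i k, 0 < β l i k) (hα : |α| ≤ 1) (hκ : 1 ≤ κ)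
    (hK : StrictMono K) (hN : ∀ m, (N m : ℝ) = κ * (K m : ℝ)) (hp : ∀ m, 0 < pTr p (τ m))
    (hΨ : ∀ m, Ψ m * (Ψ m)ᴴ = 1) (hk : ∀ m, k < K m) (hS : ∀ m, IsModel P β α l (S m)) :
    ∀ᵐ ω ∂P, (∀ m, (((S m ω).estimate β p l (Ψ m) l)ᴴ *
        (S m ω).estimate β p l (Ψ m) l).det ≠ 0) →
      Tendsto (fun m => (normSq ((S m ω).zfRow β p l (Ψ m) ⟨k, hk m⟩))⁻¹ / K m
        - betaHat β p (τ m) l l k * (κ - 1)) atTop (𝓝 0) := by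
  have hev : ∀ n : ℕ, ∀ᵐ ω ∂P, ∀ᶠ m in atTop, ω ∉ {ω |
      (((S m ω).estimate β p l (Ψ m) l)ᴴ * (S m ω).estimate β p l (Ψ m) l).det ≠ 0 ∧
        1 / ((n : ℝ) + 1) * K m ≤ |(normSq ((S m ω).zfRow β p l (Ψ m) ⟨k, hk m⟩))⁻¹
          - betaHat β p (τ m) l l k * ((N m : ℝ) + 1 - K m)|} := by
    intro n
    obtain ⟨s, hs0, hs, c, hc, hrate⟩ := exists_exponential_rate (hβ l k)
      (show 0 < κ by linarith) (show 0 < 1 / ((n : ℝ) + 1) by positivity)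
    refine ae_eventually_not_of_exponential hc fun m => ?_
    refine (measure_inv_normSq_zfRow_le (hS m) hβ hα (hp m) (hΨ m) ⟨k, hk m⟩ le_rfl hs0 hs
      _).trans (ENNReal.ofReal_le_ofReal ?_)
    have h1 : (1 : ℝ) ≤ K m := by exact_mod_cast (Nat.zero_le k).trans_lt (hk m)
    have h2 : (m : ℝ) ≤ K m := by exact_mod_cast hK.le_apply
    -- The number of degrees of freedom is at most `N = κ K` because `K ≥ 1`.
    have h3 := hrate (K m) ((N m : ℝ) + 1 - K m) (by rw [hN]; linarith) (by linarith)
    have h4 : c * m ≤ c * K m := by gcongr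
    gcongr
    exact h3.trans (by linarith)
  filter_upwards [ae_all_iff.2 hev] with ω hω hdet
  have hKtop : Tendsto (fun m => (K m : ℝ)) atTop atTop :=
    tendsto_natCast_atTop_atTop.comp hK.tendsto_atTop
  have hKpos : ∀ m, (0 : ℝ) < K m := fun m => by exact_mod_cast (Nat.zero_le k).trans_lt (hk m)
  have h1 : Tendsto (fun m => (normSq ((S m ω).zfRow β p l (Ψ m) ⟨k, hk m⟩))⁻¹ / K m
      - betaHat β p (τ m) l l k * ((N m : ℝ) + 1 - K m) / K m) atTop (𝓝 0) := by
    refine tendsto_zero_of_eventually_abs_lt fun n => ?_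
    filter_upwards [hω n] with m hm
    rw [← sub_div, abs_div, abs_of_pos (hKpos m), div_lt_iff₀ (hKpos m)]
    by_contra hcon
    exact hm ⟨hdet m, not_lt.1 hcon⟩
  -- The extra `1` in `N + 1 - K` contributes `β̂ / K`, which vanishes in the limit.
  have h2 : Tendsto (fun m => betaHat β p (τ m) l l k / K m) atTop (𝓝 0) := by
    refine squeeze_zero (fun m => div_nonneg (betaHat_pos hβ (hp m) l k).le (hKpos m).le)
      (fun m => ?_) ((tendsto_const_nhds (x := β l l k)).div_atTop hKtop)
    have := hKpos m
    gcongr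
    exact betaHat_le hβ (hp m) l k
  have h3 := h1.add h2
  rw [add_zero] at h3
  refine h3.congr fun m => ?_
  have := (hKpos m).ne'
  rw [hN]
  field_simp
  ring

/-- The normalised interference caused by an error matrix approaches its deterministic
equivalent. -/
theorem ae_tendsto_normSq_zfRow_vecMul (hβ : ∀ i k, 0 < β l i k) (hα : |α| ≤ 1)
    (hK : StrictMono K) (hp : ∀ m, 0 < pTr p (τ m))
    (hΨ : ∀ m, Ψ m * (Ψ m)ᴴ = 1) {B : ℝ}
    (hD : ∀ m i, specNorm (errorCov β α p (τ m) l i (K m)) ≤ B)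
    (hk : ∀ m, k < K m) (hS : ∀ m, IsModel P β α l (S m)) (i : Fin L) :
    ∀ᵐ ω ∂P, (∀ m, (((S m ω).estimate β p l (Ψ m) l)ᴴ *
        (S m ω).estimate β p l (Ψ m) l).det ≠ 0) →
      Tendsto (fun m => normSq ((S m ω).zfRow β p l (Ψ m) ⟨k, hk m⟩ ᵥ*
          (S m ω).errorMatrix β α p l (Ψ m) i) /
            (K m * normSq ((S m ω).zfRow β p l (Ψ m) ⟨k, hk m⟩))
        - 1 / (K m : ℝ) * (errorCov β α p (τ m) l i (K m)).trace) atTop (𝓝 0) := by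
  have hev : ∀ n : ℕ, ∀ᵐ ω ∂P, ∀ᶠ m in atTop, ω ∉ {ω |
      (((S m ω).estimate β p l (Ψ m) l)ᴴ * (S m ω).estimate β p l (Ψ m) l).det ≠ 0 ∧
        1 / ((n : ℝ) + 1) * K m * normSq ((S m ω).zfRow β p l (Ψ m) ⟨k, hk m⟩) ≤
          |normSq ((S m ω).zfRow β p l (Ψ m) ⟨k, hk m⟩ ᵥ* (S m ω).errorMatrix β α p l (Ψ m) i)
            - normSq ((S m ω).zfRow β p l (Ψ m) ⟨k, hk m⟩)
              * (errorCov β α p (τ m) l i (K m)).trace|} := by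
    intro n
    -- `max B 1` replaces `B` to have a strictly positive bound.
    obtain ⟨s, hs0, hs, c, hc, hrate⟩ := exists_exponential_rate
      (show 0 < max B 1 from lt_max_of_lt_right one_pos) one_pos
      (show 0 < 1 / ((n : ℝ) + 1) by positivity)
    refine ae_eventually_not_of_exponential hc fun m => ?_
    refine (measure_normSq_zfRow_vecMul_le (hS m) hβ hα (hp m) (hΨ m) i ⟨k, hk m⟩
      (fun k' => (errorVar_le_specNorm i k').trans ((hD m i).trans (le_max_left B 1))) hs0 hs
      _).trans (ENNReal.ofReal_le_ofReal ?_)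
    have h2 : (m : ℝ) ≤ K m := by exact_mod_cast hK.le_apply
    have h3 := hrate (K m) (K m) (by rw [one_mul]) (Nat.cast_nonneg _)
    have h4 : c * m ≤ c * K m := by gcongr
    gcongr
    exact h3.trans (by linarith)
  filter_upwards [ae_all_iff.2 hev] with ω hω hdet
  refine tendsto_zero_of_eventually_abs_lt fun n => ?_
  filter_upwards [hω n] with m hm
  have hKpos : (0 : ℝ) < K m := by exact_mod_cast (Nat.zero_le k).trans_lt (hk m)
  have hw : 0 < normSq ((S m ω).zfRow β p l (Ψ m) ⟨k, hk m⟩) :=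
    normSq_pinv_pos (hdet m) ⟨k, hk m⟩
  set W := normSq ((S m ω).zfRow β p l (Ψ m) ⟨k, hk m⟩) with hW
  set D := (errorCov β α p (τ m) l i (K m)).trace with hDdef
  have h1 : ∀ Q : ℝ, Q / (K m * W) - 1 / (K m : ℝ) * D = (Q - W * D) / (K m * W) := by
    intro Q
    field_simp
  rw [h1, abs_div, abs_of_pos (mul_pos hKpos hw), div_lt_iff₀ (mul_pos hKpos hw), ← mul_assoc]
  by_contra hcon
  exact hm ⟨hdet m, not_lt.1 hcon⟩

theorem abs_avgErrorTrace_le {K τ : ℕ} (hβ : ∀ i k, 0 < β l i k) (hα : |α| ≤ 1)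
    (hp : 0 < pTr p τ) (hK : 0 < K) {B : ℝ} (hD : ∀ i, specNorm (errorCov β α p τ l i K) ≤ B) :
    0 ≤ avgErrorTrace β α p τ l K ∧ avgErrorTrace β α p τ l K ≤ L * B := by
  have hK' : (0 : ℝ) < K := by exact_mod_cast hK
  have h0 : ∀ i, (errorCov β α p τ l i K).trace
      = ∑ k : Fin K, (β l i k - α ^ 2 * betaHat β p τ l i k) := fun i => Matrix.trace_diagonal _
  constructor
  · refine Finset.sum_nonneg fun i _ => mul_nonneg (by positivity) ?_
    rw [h0]
    exact Finset.sum_nonneg fun k _ => errorVar_nonneg hβ hα hp i k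
  · calc avgErrorTrace β α p τ l K ≤ ∑ _i : Fin L, B := by
          refine Finset.sum_le_sum fun i _ => ?_
          rw [one_div, inv_mul_le_iff₀ hK', h0]
          calc _ ≤ ∑ _k : Fin K, B :=
                Finset.sum_le_sum fun k _ => (errorVar_le_specNorm i k).trans (hD i)
            _ = K * B := by simp
      _ = L * B := by simp

end Sequence

end ZFUplink

/-! ### The deterministic equivalent. -/

theorem mainTheorem6 {L : ℕ} (l : Fin L) (β : Fin L → Fin L → ℕ → ℝ)
    (hβ : ∀ i k, 0 < β l i k) (α p κ : ℝ) (hα : |α| ≤ 1) (hp : 0 < p) (hκ : 1 ≤ κ)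
    (K N τ : ℕ → ℕ) (hK : StrictMono K) (hN : ∀ m, (N m : ℝ) = κ * (K m : ℝ))
    (hτ : ∀ m, K m ≤ τ m)
    (Ψ : ∀ m, Matrix (Fin (K m)) (Fin (τ m)) ℂ) (hΨ : ∀ m, Ψ m * (Ψ m)ᴴ = 1)
    (hD : ∃ B : ℝ, ∀ m i, ZFUplink.specNorm (ZFUplink.errorCov β α p (τ m) l i (K m)) ≤ B)
    (hreg : (1 < κ ∧ 2 ≤ L) ∨
      ∃ t : ℝ, 0 < t ∧ ∀ᶠ m in atTop, t ≤ ZFUplink.avgErrorTrace β α p (τ m) l (K m))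
    (k : ℕ) (hk : ∀ m, k < K m)
    {Ω : Type*} [MeasurableSpace Ω] (P : Measure Ω) [IsProbabilityMeasure P]
    (S : ∀ m, Ω → ZFUplink.Sample L (K m) (N m) (τ m))
    (hS : ∀ m, ZFUplink.IsModel P β α l (S m)) :
    ∀ᵐ ω ∂P, Tendsto
      (fun m => (S m ω).sinr β α p l (Ψ m) ⟨k, hk m⟩
        - ZFUplink.detEquiv β α p κ (τ m) l (K m) k)
      atTop (𝓝 0) := by
  open ZFUplink in
  obtain ⟨B, hB⟩ := hD
  have hK1 : ∀ m, 1 ≤ K m := fun m => (Nat.zero_le k).trans_lt (hk m)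
  have hKpos : ∀ m, (0 : ℝ) < K m := fun m => by exact_mod_cast hK1 m
  have hτ1 : ∀ m, 1 ≤ τ m := fun m => (hK1 m).trans (hτ m)
  have hptr : ∀ m, 0 < pTr p (τ m) := fun m => mul_pos (by exact_mod_cast hτ1 m) hp
  have hKN : ∀ m, K m ≤ N m := fun m => by
    have : (K m : ℝ) ≤ N m := by
      rw [hN]
      exact le_mul_of_one_le_left (hKpos m).le hκ
    exact_mod_cast this
  rcases eq_or_ne α 0 with rfl | hα0
  -- For `α = 0` both numerators vanish.
  · simp [Sample.sinr, detEquiv]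
  have hdet := ae_all_iff.2 fun m =>
    ae_estimate_gram_det_ne_zero (hS m) hβ hα (hptr m) (hΨ m) (hKN m)
  have hrow := ae_tendsto_inv_normSq_zfRow hβ hα hκ hK hN hptr hΨ hk hS
  have herr := ae_all_iff.2 fun i =>
    ae_tendsto_normSq_zfRow_vecMul hβ hα hK hptr hΨ hB hk hS i
  filter_upwards [hdet, hrow, herr] with ω hω hrowω herrω
  have huv := hrowω hω
  have hKtop : Tendsto (fun m => (K m : ℝ)) atTop atTop :=
    tendsto_natCast_atTop_atTop.comp hK.tendsto_atTop
  have hxT := tendsto_finsetSum Finset.univ fun i _ => herrω i hω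
  have hinv : Tendsto (fun m => (1 / p) / (K m : ℝ)) atTop (𝓝 0) :=
    tendsto_const_nhds.div_atTop hKtop
  rw [Finset.sum_const_zero] at hxT
  replace hxT := hxT.add hinv
  rw [add_zero] at hxT
  set W : ℕ → ℝ := fun m => normSq ((S m ω).zfRow β p l (Ψ m) ⟨k, hk m⟩) with hW
  set Q : Fin L → ℕ → ℝ := fun i m => normSq ((S m ω).zfRow β p l (Ψ m) ⟨k, hk m⟩ ᵥ*
    (S m ω).errorMatrix β α p l (Ψ m) i) with hQ
  have hWpos : ∀ m, 0 < W m := fun m => normSq_pinv_pos (hω m) ⟨k, hk m⟩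
  set C := contamination β l k with hC
  have hC0 : 0 ≤ C := contamination_nonneg β l k
  have hα2 : 0 < α ^ 2 := by positivity
  have hbpos : ∀ m, 0 < betaHat β p (τ m) l l k := fun m => betaHat_pos hβ (hptr m) l k
  have hT := fun m => abs_avgErrorTrace_le hβ hα (hptr m) (hK1 m) (hB m)
  have hv0 : ∀ m, 0 ≤ betaHat β p (τ m) l l k * (κ - 1) := fun m =>
    mul_nonneg (hbpos m).le (by linarith)
  -- Under (a) the contamination term bounds the denominator below, with `β̂` replaced by its value
  -- at `τ = 1`. Under (b) the trace term does.
  obtain ⟨c, hc, hcD⟩ : ∃ c : ℝ, 0 < c ∧ ∀ᶠ m in atTop,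
      c ≤ α ^ 2 * C * (betaHat β p (τ m) l l k * (κ - 1)) + avgErrorTrace β α p (τ m) l (K m) := by
    rcases hreg with ⟨hκ1, hL⟩ | ⟨t, ht, hreg⟩
    · have hC1 : 0 < C := contamination_pos hβ hL k
      have hb1 : 0 < betaHat β p 1 l l k := betaHat_pos hβ (by simpa [pTr] using hp) l k
      have hκ2 : 0 < κ - 1 := by linarith
      refine ⟨α ^ 2 * C * (betaHat β p 1 l l k * (κ - 1)), by positivity,
        Eventually.of_forall fun m => ?_⟩
      refine le_add_of_le_of_nonneg ?_ (hT m).1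
      gcongr
      exact le_betaHat hβ hp (hτ1 m) l k
    · refine ⟨t, ht, hreg.mono fun m hm => ?_⟩
      exact le_add_of_nonneg_of_le (mul_nonneg (by positivity) (hv0 m)) hm
  have hmain := tendsto_quotient_sub_quotient (a := α ^ 2) (C := C)
    (V := β l l k * (κ - 1)) (T₀ := L * B)
    (u := fun m => (W m)⁻¹ / K m) (v := fun m => betaHat β p (τ m) l l k * (κ - 1))
    (x := fun m => ∑ i, Q i m / (K m * W m) + 1 / p / K m)
    (T := fun m => avgErrorTrace β α p (τ m) l (K m)) hc
    (fun m => by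
      rw [abs_of_nonneg (hv0 m)]
      have : 0 ≤ κ - 1 := by linarith
      gcongr
      exact betaHat_le hβ (hptr m) l k)
    (fun m => by rw [abs_of_nonneg (hT m).1]; exact (hT m).2) hcD huv
    (hxT.congr fun m => by
      rw [Finset.sum_sub_distrib, avgErrorTrace]
      ring)
  refine hmain.congr fun m => ?_
  rw [sinr_eq hβ (hω m), detEquiv]
  have h1 := (hWpos m).ne'
  have h2 := (hKpos m).ne'
  congr 1
  -- Restoring the common factor `p K ‖w_k‖²` recovers the SINR from the normalised quotient.
  · rw [← mul_div_mul_left (α ^ 2 * ((W m)⁻¹ / K m)) _ (show p * K m * W m ≠ 0 by positivity)]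
    congr 1
    · field_simp
    · rw [← Finset.sum_div]
      field_simp
      change p * α ^ 2 * C + (p * ∑ i, Q i m + W m) = p * (α ^ 2 * C + ∑ i, Q i m) + W m
      ring
  · congr 1
    · ring
    · ring
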